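/- Let $M$ be a compact connected (Hausdorff) topological manifold, with or without boundary, of dimension $d\ge 1$, which is not homeomorphic to a closed interval, and let $n\ge 2$. Fix any metric on $M$ inducing its topology, and equip the group $\mathrm{Homeo}(M)$ of all homeomorphisms of $M$ with the $C^0$ metric $\rho(f,g)=\sup_{x\in M}d(f(x),g(x))$. Let $\mathrm{Homeo}_0(M)$ be the connected component of the identity in $\mathrm{Homeo}(M)$. Then there are $f_1,\dots,f_n\in\mathrm{Homeo}_0(M)$ and $r>0$ such that for all $\tilde f_1,\dots,\tilde f_n\in\mathrm{Homeo}(M)$ with $\rho(\tilde f_i,f_i)<r$ for $i=1,\dots,n$, the subgroup $\langle\tilde f_1,\dots,\tilde f_n\rangle$ is discrete in the $C^0$ metric and is free of rank $n$, with free basis $\tilde f_1,\dots,\tilde f_n$. Suppose moreover that $M$ is a smooth manifold, with or without boundary. For $1\le k\le\infty$ let $\mathrm{Diff}^k(M)$ be the group of all $C^k$ diffeomorphisms of $M$ with the $C^k$ topology (uniform convergence, on compact subsets of charts, of local representatives together with all their derivatives of order $\le k$, respectively of every finite order if $k=\infty$), and let $\mathrm{Diff}^k_0(M)$ be the connected component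 of the identity in it. Then for every $k$ with $1\le k\le\infty$ there are $f_1,\dots,f_n\in\mathrm{Diff}^\infty_0(M)$, which also lie in $\mathrm{Diff}^k_0(M)$, and neighbourhoods $U_i$ of $f_i$ in $\mathrm{Diff}^k(M)$ such that for all $\tilde f_1\in U_1,\dots,\tilde f_n\in U_n$ the subgroup $\langle\tilde f_1,\dots,\tilde f_n\rangle$ is discrete in the $C^k$ topology and free of rank $n$ with free basis $\tilde f_1,\dots,\tilde f_n$. Consequently, for every metric $\rho_k$ on $\mathrm{Diff}^k(M)$ that induces the $C^k$ topology (a $C^k$ metric), there is $r>0$ such that the same conclusion holds for all $\tilde f_1,\dots,\tilde f_n\in\mathrm{Diff}^k(M)$ with $\rho_k(\tilde f_i,f_i)<r$ for $i=1,\dots,n$. -/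

import Mathlib

open Set Topology
open scoped Manifold ContDiff

noncomputable section

/-- The subgroup generated by `g 0, …, g (n - 1)` is discrete (in the subspace topology) and is a
free group with free basis `g 0, …, g (n - 1)`; in particular it is free of rank `n`. -/
def GeneratesDiscreteFree {G : Type*} [Group G] [TopologicalSpace G] {n : ℕ} (g : Fin n → G) :
    Prop :=
  DiscreteTopology (Subgroup.closure (Set.range g)) ∧
    ∃ b : FreeGroupBasis (Fin n) (Subgroup.closure (Set.range g)), ∀ i, (b i : G) = g i

/-! ### Homeomorphism groups -/

/-- The `C^0` metric `d(f, g) = sup_x d(f x, g x)` on the group of homeomorphisms of a compact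
metric space: the metric of `C(M, M)`, restricted to homeomorphisms. -/
instance homeoMetricSpace {M : Type*} [MetricSpace M] [CompactSpace M] : MetricSpace (M ≃ₜ M) :=
  MetricSpace.induced (fun f : M ≃ₜ M => (⟨f, f.continuous⟩ : C(M, M)))
    (fun _ _ h => Homeomorph.ext fun x => DFunLike.congr_fun h x) inferInstance

theorem homeo_dist_eq {M : Type*} [MetricSpace M] [CompactSpace M] (f g : M ≃ₜ M) :
    dist f g = ⨆ x, dist (f x) (g x) :=
  ContinuousMap.dist_eq_iSup

/-- `Homeo₀(M)`: the connected component of the identity in the group of homeomorphisms of `M`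
(with the topology of uniform convergence). -/
def homeoZero (M : Type*) [MetricSpace M] [CompactSpace M] : Set (M ≃ₜ M) :=
  connectedComponent 1

/-! ### Diffeomorphism groups -/

section Diffeo

variable {E : Type*} [NormedAddCommGroup E] [NormedSpace ℝ E]
  {H : Type*} [TopologicalSpace H] {I : ModelWithCorners ℝ E H}
  {M : Type*} [TopologicalSpace M] [ChartedSpace H M]

/-- The group of `C^k` diffeomorphisms of `M` under composition. -/
instance diffeoGroup {k : WithTop ℕ∞} : Group (M ≃ₘ^k⟮I, I⟯ M) where
  mul f g := g.trans f
  one := Diffeomorph.refl I M k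
  inv f := f.symm
  mul_assoc _ _ _ := rfl
  one_mul _ := rfl
  mul_one _ := rfl
  inv_mul_cancel f := Diffeomorph.ext fun x => f.symm_apply_apply x

theorem diffeo_mul_apply {k : WithTop ℕ∞} (f g : M ≃ₘ^k⟮I, I⟯ M) (x : M) :
    (f * g) x = f (g x) := rfl

/-- The basic `C^j`-neighbourhood `N^j(f; φ, ψ, K, ε)` of a diffeomorphism `f`: the set of all `g`
with `g(K) ⊆ dom ψ` such that on `φ(K)` all derivatives of order `m ≤ j` of the local
representatives `ψ ∘ g ∘ φ⁻¹` and `ψ ∘ f ∘ φ⁻¹` differ by less than `ε`. (Derivatives are taken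
within `range I`, i.e. within the model half space or the whole model space.) -/
def diffeoBasicNhd {k : WithTop ℕ∞} (j : ℕ) (f : M ≃ₘ^k⟮I, I⟯ M)
    (φ ψ : OpenPartialHomeomorph M H) (K : Set M) (ε : ℝ) : Set (M ≃ₘ^k⟮I, I⟯ M) :=
  {g | MapsTo g K ψ.source ∧ ∀ m ≤ j, ∀ x ∈ K,
    ‖iteratedFDerivWithin ℝ m (ψ.extend I ∘ g ∘ (φ.extend I).symm) (range I) (φ.extend I x) -
      iteratedFDerivWithin ℝ m (ψ.extend I ∘ f ∘ (φ.extend I).symm) (range I) (φ.extend I x)‖ < ε}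

/-- The `C^k` topology on the group of `C^k` diffeomorphisms of `M` (for `k = ∞`, the `C^∞`
topology): it is generated by the sets `N^j(f; φ, ψ, K, ε)`, where `j` is a natural number with
`j ≤ k`, `φ` and `ψ` are smooth charts of `M`, `K ⊆ dom φ` is compact, `f(K) ⊆ dom ψ`, and
`ε > 0`. -/
instance diffeoTopology {k : WithTop ℕ∞} : TopologicalSpace (M ≃ₘ^k⟮I, I⟯ M) :=
  TopologicalSpace.generateFrom
    {S | ∃ (j : ℕ) (f : M ≃ₘ^k⟮I, I⟯ M) (φ ψ : OpenPartialHomeomorph M H) (K : Set M) (ε : ℝ),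
      (j : WithTop ℕ∞) ≤ k ∧
      φ ∈ IsManifold.maximalAtlas I ∞ M ∧ ψ ∈ IsManifold.maximalAtlas I ∞ M ∧
      IsCompact K ∧ K ⊆ φ.source ∧ MapsTo f K ψ.source ∧ 0 < ε ∧
      S = diffeoBasicNhd j f φ ψ K ε}

variable (I M) in
/-- `Diff₀^k(M)`: the connected component of the identity in the group of `C^k` diffeomorphisms
of `M` with the `C^k` topology. -/
def diffeoZero (k : WithTop ℕ∞) : Set (M ≃ₘ^k⟮I, I⟯ M) :=
  connectedComponent 1

/-- A smooth diffeomorphism, regarded as a `C^k` diffeomorphism. -/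
def smoothToCk (k : ℕ∞) (f : M ≃ₘ^∞⟮I, I⟯ M) : M ≃ₘ^(k : WithTop ℕ∞)⟮I, I⟯ M where
  toEquiv := f.toEquiv
  contMDiff_toFun := f.contMDiff.of_le (by exact_mod_cast (le_top : k ≤ ⊤))
  contMDiff_invFun := f.symm.contMDiff.of_le (by exact_mod_cast (le_top : k ≤ ⊤))

end Diffeo

end

noncomputable section

/-! ### Ping-pong -/

section PingPong

variable {M : Type*} {G : Type*} [Group G] {n : ℕ}

theorem prod_reduced_word_mem {ρ : G →* Equiv.Perm M} {X : Option (Fin n × Bool) → Set M}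
    {g : Fin n → G}
    (hg : ∀ (a : Fin n × Bool) (j : Option (Fin n × Bool)), j ≠ some (a.1, !a.2) →
      MapsTo (ρ (bif a.2 then g a.1 else (g a.1)⁻¹)) (X j) (X (some a)))
    {q : M} (hq : q ∈ X none) (L : List (Fin n × Bool)) :
    ∀ a, FreeGroup.IsReduced (a :: L) →
      ρ ((a :: L).map fun x => bif x.2 then g x.1 else (g x.1)⁻¹).prod q ∈ X (some a) := by
  induction L with
  | nil =>
    intro a _
    simpa using hg a none (by simp) hq
  | cons b L ih =>
    intro a h
    rw [FreeGroup.isReduced_cons_cons] at h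
    have h2 := ih b h.2
    rw [List.map_cons, List.prod_cons, map_mul, Equiv.Perm.mul_apply]
    refine hg a (some b) ?_ h2
    rintro heq
    rw [Option.some.injEq] at heq
    subst heq
    simpa using h.1

theorem lift_apply_mem_of_ne_one {ρ : G →* Equiv.Perm M} {X : Option (Fin n × Bool) → Set M}
    {g : Fin n → G}
    (hg : ∀ (a : Fin n × Bool) (j : Option (Fin n × Bool)), j ≠ some (a.1, !a.2) →
      MapsTo (ρ (bif a.2 then g a.1 else (g a.1)⁻¹)) (X j) (X (some a)))
    {q : M} (hq : q ∈ X none) {w : FreeGroup (Fin n)} (hw : w ≠ 1) :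
    ρ (FreeGroup.lift g w) q ∈ ⋃ a, X (some a) := by
  obtain ⟨L, hL⟩ : ∃ L, w.toWord = L := ⟨_, rfl⟩
  have hred : FreeGroup.IsReduced L := hL ▸ FreeGroup.isReduced_toWord
  have hw' : w = FreeGroup.mk L := by rw [← hL, FreeGroup.mk_toWord]
  cases L with
  | nil => exact absurd (FreeGroup.toWord_eq_nil_iff.1 hL) hw
  | cons a L =>
    rw [hw', FreeGroup.lift_mk]
    exact mem_iUnion.2 ⟨a, prod_reduced_word_mem hg hq L a hred⟩

theorem generatesDiscreteFree_of_pingPong [TopologicalSpace M] [TopologicalSpace G]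
    (ρ : G →* Equiv.Perm M) (hcont : ∀ g, Continuous (ρ g))
    (hev : ∀ (x : M) (O : Set M), IsOpen O → IsOpen {g | ρ g x ∈ O})
    {X : Option (Fin n × Bool) → Set M} (hX : ∀ a, IsClosed (X (some a)))
    {g : Fin n → G}
    (hg : ∀ (a : Fin n × Bool) (j : Option (Fin n × Bool)), j ≠ some (a.1, !a.2) →
      MapsTo (ρ (bif a.2 then g a.1 else (g a.1)⁻¹)) (X j) (X (some a)))
    {q : M} (hq : q ∈ X none) (hq' : ∀ a, q ∉ X (some a)) : GeneratesDiscreteFree g := by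
  have hXc : IsClosed (⋃ a, X (some a)) := isClosed_iUnion_of_finite hX
  have hqX : q ∉ ⋃ a, X (some a) := by simpa using hq'
  have hinj : Function.Injective (FreeGroup.lift g) := by
    rw [injective_iff_map_eq_one]
    intro w hw
    by_contra hne
    have := lift_apply_mem_of_ne_one hg hq hne
    rw [hw, map_one, Equiv.Perm.one_apply] at this
    exact hqX this
  have hrange : (FreeGroup.lift g).range = Subgroup.closure (range g) :=
    FreeGroup.range_lift_eq_closure
  refine ⟨?_, ?_⟩
  · refine discreteTopology_iff_isOpen_singleton.2 fun h => ?_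
    have hO : IsOpen {k : G | ρ k q ∈ (ρ (h : G)⁻¹ ⁻¹' (⋃ a, X (some a)))ᶜ} :=
      hev q _ (hXc.preimage (hcont _)).isOpen_compl
    have : ({h} : Set (Subgroup.closure (range g))) =
        Subtype.val ⁻¹' {k : G | ρ k q ∈ (ρ (h : G)⁻¹ ⁻¹' (⋃ a, X (some a)))ᶜ} := by
      ext k
      simp only [mem_singleton_iff, mem_preimage, mem_ofPred_eq, mem_compl_iff]
      rw [← Equiv.Perm.mul_apply, ← map_mul]
      constructor
      · rintro rfl
        rwa [inv_mul_cancel, map_one, Equiv.Perm.one_apply]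
      · intro hk
        by_contra hne
        have hmem : (h : G)⁻¹ * k ∈ (FreeGroup.lift g).range := by
          rw [hrange]
          exact mul_mem (inv_mem h.2) k.2
        obtain ⟨w, hw⟩ := hmem
        apply hk
        rw [← hw]
        apply lift_apply_mem_of_ne_one hg hq
        rintro rfl
        rw [map_one] at hw
        exact hne (Subtype.ext (inv_mul_eq_one.1 hw.symm).symm)
    rw [this]
    exact hO.preimage continuous_subtype_val
  · let e : FreeGroup (Fin n) ≃* Subgroup.closure (range g) :=
      (MonoidHom.ofInjective hinj).trans (MulEquiv.subgroupCongr hrange)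
    refine ⟨FreeGroupBasis.ofRepr e.symm, fun i => ?_⟩
    change ((e (FreeGroup.of i) : Subgroup.closure (range g)) : G) = g i
    exact FreeGroup.lift_apply_of

end PingPong

end

noncomputable section

/-! ### The `C^k` topology -/

section CkTopology

theorem contDiffWithinAt_iteratedFDerivWithin_param {P E F : Type*} [NormedAddCommGroup P]
    [NormedSpace ℝ P] [NormedAddCommGroup E] [NormedSpace ℝ E] [NormedAddCommGroup F]
    [NormedSpace ℝ F] {s : Set E} (hs : UniqueDiffOn ℝ s) {G : P → E → F} {p : P × E}
    (hp : p.2 ∈ s) (m : ℕ) : ∀ n : ℕ,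
    ContDiffWithinAt ℝ ((n + m : ℕ) : WithTop ℕ∞) (Function.uncurry G) (univ ×ˢ s) p →
    ContDiffWithinAt ℝ (n : WithTop ℕ∞)
      (fun p : P × E => iteratedFDerivWithin ℝ m (G p.1) s p.2) (univ ×ˢ s) p := by
  induction m with
  | zero =>
    intro n h
    simp only [iteratedFDerivWithin_zero_eq_comp]
    exact (continuousMultilinearCurryFin0 ℝ E F).symm.contDiff.comp_contDiffWithinAt h
  | succ m ih =>
    intro n h
    have h1 := ih (n + 1) (by convert h using 2; ring)
    simp only [iteratedFDerivWithin_succ_eq_comp_left]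
    have h2 : ContDiffWithinAt ℝ (n : WithTop ℕ∞)
        (fun p : P × E => fderivWithin ℝ (iteratedFDerivWithin ℝ m (G p.1) s) s p.2)
        (univ ×ˢ s) p := by
      refine ContDiffWithinAt.fderivWithin (n := ((n + 1 : ℕ) : WithTop ℕ∞))
        (f := fun (p : P × E) z => iteratedFDerivWithin ℝ m (G p.1) s z) (g := Prod.snd) ?_
        contDiffWithinAt_snd hs (by push_cast; exact le_rfl) ⟨mem_univ _, hp⟩ fun x hx => hx.2
      refine ContDiffWithinAt.comp (t := univ ×ˢ s) (p, p.2)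
        (g := fun q : P × E => iteratedFDerivWithin ℝ m (G q.1) s q.2)
        (f := fun q : (P × E) × E => (q.1.1, q.2)) h1 ?_ ?_
      · exact ((contDiff_fst.comp contDiff_fst).prodMk contDiff_snd).contDiffWithinAt
      · rintro q hq
        exact ⟨mem_univ _, hq.2⟩
    exact h2.continuousLinearMap_comp
      ((continuousMultilinearCurryLeftEquiv ℝ (fun _ : Fin (m + 1) => E) F).symm :
        _ →L[ℝ] E [×(m + 1)]→L[ℝ] F)

variable {E : Type*} [NormedAddCommGroup E] [NormedSpace ℝ E]
  {H : Type*} [TopologicalSpace H] {I : ModelWithCorners ℝ E H}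
  {M : Type*} [TopologicalSpace M] [ChartedSpace H M]

theorem isOpen_diffeoBasicNhd {k : WithTop ℕ∞} {j : ℕ} {f : M ≃ₘ^k⟮I, I⟯ M}
    {φ ψ : OpenPartialHomeomorph M H} {K : Set M} {ε : ℝ} (hj : (j : WithTop ℕ∞) ≤ k)
    (hφ : φ ∈ IsManifold.maximalAtlas I ∞ M) (hψ : ψ ∈ IsManifold.maximalAtlas I ∞ M)
    (hK : IsCompact K) (hKφ : K ⊆ φ.source) (hf : MapsTo f K ψ.source) (hε : 0 < ε) :
    IsOpen (diffeoBasicNhd j f φ ψ K ε) :=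
  TopologicalSpace.isOpen_generateFrom_of_mem
    ⟨j, f, φ, ψ, K, ε, hj, hφ, hψ, hK, hKφ, hf, hε, rfl⟩

theorem mem_diffeoBasicNhd_self {k : WithTop ℕ∞} {j : ℕ} {f : M ≃ₘ^k⟮I, I⟯ M}
    {φ ψ : OpenPartialHomeomorph M H} {K : Set M} {ε : ℝ} (hf : MapsTo f K ψ.source)
    (hε : 0 < ε) : f ∈ diffeoBasicNhd j f φ ψ K ε :=
  ⟨hf, fun m _ x _ => by simpa using hε⟩

/-- The `C^k` topology is finer than the compact-open topology. -/
theorem isOpen_diffeo_mapsTo [IsManifold I ∞ M] [T2Space M] [LocallyCompactSpace M]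
    {k : WithTop ℕ∞} {K O : Set M} (hK : IsCompact K) (hO : IsOpen O) :
    IsOpen {g : M ≃ₘ^k⟮I, I⟯ M | MapsTo g K O} := by
  rw [isOpen_iff_mem_nhds]
  intro f hf
  have key : ∀ x ∈ K, ∃ L ∈ 𝓝 x, ∀ᶠ g : M ≃ₘ^k⟮I, I⟯ M in 𝓝 f, MapsTo g L O := by
    intro x hx
    set φ := chartAt H x
    set ψ := chartAt H (f x)
    have hfx : f x ∈ ψ.source := mem_chart_source H (f x)
    have hO' : O ∩ ψ.source ∈ 𝓝 (f x) :=
      (hO.inter ψ.open_source).mem_nhds ⟨hf hx, hfx⟩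
    have h1 : (ψ.extend I).symm ⁻¹' (O ∩ ψ.source) ∈ 𝓝 (ψ.extend I (f x)) := by
      have := ψ.extend_preimage_mem_nhds (I := I) hfx hO'
      exact this
    obtain ⟨ε, hε, hball⟩ := Metric.mem_nhds_iff.1 h1
    have h2 : ∀ᶠ y in 𝓝 x, y ∈ φ.source ∧ f y ∈ ψ.source ∧
        ψ.extend I (f y) ∈ Metric.ball (ψ.extend I (f x)) (ε / 2) := by
      have hfc : ContinuousAt f x := f.continuous.continuousAt
      refine Filter.Eventually.and (φ.open_source.mem_nhds (mem_chart_source H x))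
        (Filter.Eventually.and (hfc (ψ.open_source.mem_nhds hfx)) ?_)
      exact ((ψ.continuousAt_extend hfx).comp hfc) (Metric.ball_mem_nhds _ (half_pos hε))
    obtain ⟨L, hL, hLs, hLc⟩ := local_compact_nhds h2
    refine ⟨L, hL, ?_⟩
    have hLψ : MapsTo f L ψ.source := fun y hy => (hLs hy).2.1
    have hopen : IsOpen (diffeoBasicNhd 0 f φ ψ L (ε / 2)) :=
      isOpen_diffeoBasicNhd (by simp) (IsManifold.chart_mem_maximalAtlas x)
        (IsManifold.chart_mem_maximalAtlas (f x)) hLc (fun y hy => (hLs hy).1) hLψ (half_pos hε)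
    filter_upwards [hopen.mem_nhds (mem_diffeoBasicNhd_self hLψ (half_pos hε))] with g hg y hy
    have h3 := hg.2 0 le_rfl y hy
    have h4 : (φ.extend I).symm (φ.extend I y) = y := φ.extend_left_inv (hLs hy).1
    rw [iteratedFDerivWithin_zero_eq_comp, iteratedFDerivWithin_zero_eq_comp,
      Function.comp_apply,
      Function.comp_apply (f := (continuousMultilinearCurryFin0 ℝ E E).symm)
        (g := ψ.extend I ∘ f ∘ (φ.extend I).symm), ← map_sub, LinearIsometryEquiv.norm_map] at h3
    simp only [Function.comp_apply, h4] at h3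
    have h5 : ψ.extend I (g y) ∈ Metric.ball (ψ.extend I (f x)) ε := by
      have h6 := (hLs hy).2.2
      rw [Metric.mem_ball, dist_eq_norm] at h6 ⊢
      calc _ = ‖(ψ.extend I (g y) - ψ.extend I (f y)) +
            (ψ.extend I (f y) - ψ.extend I (f x))‖ := by congr 1; abel
        _ ≤ _ := norm_add_le _ _
        _ < ε := by linarith
    have h7 := (hball h5).1
    rwa [ψ.extend_left_inv (hg.1 hy)] at h7
  choose! L hL hLO using key
  obtain ⟨t, htK, hcov⟩ := hK.elim_nhds_subcover L hL
  have : ∀ᶠ g : M ≃ₘ^k⟮I, I⟯ M in 𝓝 f, ∀ x ∈ t, MapsTo g (L x) O :=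
    (Finset.eventually_all t).2 fun x hx => hLO x (htK x hx)
  filter_upwards [this] with g hg y hy
  obtain ⟨x, hx, hy'⟩ := mem_iUnion₂.1 (hcov hy)
  exact hg x hx hy'

theorem contDiffWithinAt_localRep [IsManifold I ∞ M] {n : ℕ∞} {P : Type*} [NormedAddCommGroup P]
    [NormedSpace ℝ P] {F : P → M → M}
    (hF : ContMDiff (𝓘(ℝ, P).prod I) I n (fun p : P × M => F p.1 p.2))
    {φ ψ : OpenPartialHomeomorph M H} (hφ : φ ∈ IsManifold.maximalAtlas I ∞ M)
    (hψ : ψ ∈ IsManifold.maximalAtlas I ∞ M) {t : P} {x : M} (hx : x ∈ φ.source)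
    (hFx : F t x ∈ ψ.source) :
    ContDiffWithinAt ℝ n (Function.uncurry fun t => ψ.extend I ∘ F t ∘ (φ.extend I).symm)
      (univ ×ˢ range I) (t, φ.extend I x) := by
  have hn : (n : WithTop ℕ∞) ≤ ∞ := by exact_mod_cast (le_top : n ≤ ⊤)
  rw [← contMDiffWithinAt_iff_contDiffWithinAt]
  have h1 : ContMDiffAt I 𝓘(ℝ, E) n (ψ.extend I) (F t x) :=
    (ψ.contMDiffAt_extend hψ hFx).of_le hn
  have h2 : ContMDiffWithinAt 𝓘(ℝ, E) I n (φ.extend I).symm (range I) (φ.extend I x) := by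
    have := (contMDiffOn_extend_symm hφ).of_le hn
    have h3 := this (φ.extend I x) ⟨φ x, φ.map_source hx, rfl⟩
    refine h3.mono_of_mem_nhdsWithin ?_
    have := φ.extend_target_mem_nhdsWithin (I := I) hx
    rwa [φ.extend_target'] at this
  have h0 : (φ.extend I).symm (φ.extend I x) = x := φ.extend_left_inv hx
  have h4 : ContMDiffWithinAt 𝓘(ℝ, P × E) (𝓘(ℝ, P).prod I) n
      (fun p : P × E => (p.1, (φ.extend I).symm p.2)) (univ ×ˢ range I) (t, φ.extend I x) := by
    refine ContMDiffWithinAt.prodMk ?_ ?_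
    · exact contDiffWithinAt_fst.contMDiffWithinAt
    · exact h2.comp (t, φ.extend I x) contDiffWithinAt_snd.contMDiffWithinAt
        (fun p hp => hp.2)
  have h5 : ContMDiffWithinAt 𝓘(ℝ, P × E) I n
      (fun p : P × E => F p.1 ((φ.extend I).symm p.2)) (univ ×ˢ range I) (t, φ.extend I x) := by
    exact (hF.contMDiffAt (x := (t, (φ.extend I).symm (φ.extend I x)))).comp_contMDiffWithinAt
      (t, φ.extend I x) h4
  have h1' : ContMDiffAt I 𝓘(ℝ, E) n (ψ.extend I)
      (F t ((φ.extend I).symm (φ.extend I x))) := by rwa [h0]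
  exact h1'.comp_contMDiffWithinAt (t, φ.extend I x) h5

theorem continuousAt_iteratedFDerivWithin_localRep [IsManifold I ∞ M] {n : ℕ∞} {P : Type*}
    [NormedAddCommGroup P] [NormedSpace ℝ P] {F : P → M → M}
    (hF : ContMDiff (𝓘(ℝ, P).prod I) I n (fun p : P × M => F p.1 p.2))
    {φ ψ : OpenPartialHomeomorph M H} (hφ : φ ∈ IsManifold.maximalAtlas I ∞ M)
    (hψ : ψ ∈ IsManifold.maximalAtlas I ∞ M) {t : P} {x : M} (hx : x ∈ φ.source)
    (hFx : F t x ∈ ψ.source) {m : ℕ} (hm : (m : ℕ∞) ≤ n) :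
    ContinuousAt (fun p : P × M => iteratedFDerivWithin ℝ m
      (ψ.extend I ∘ F p.1 ∘ (φ.extend I).symm) (range I) (φ.extend I p.2)) (t, x) := by
  have h1 := (contDiffWithinAt_localRep hF hφ hψ hx hFx).of_le
    (show ((0 + m : ℕ) : WithTop ℕ∞) ≤ n by rw [zero_add]; exact_mod_cast hm)
  have h2 := (contDiffWithinAt_iteratedFDerivWithin_param I.uniqueDiffOn
    (mem_range_self _) m 0 h1).continuousWithinAt
  have h3 : ContinuousAt (fun p : P × M => (p.1, φ.extend I p.2)) (t, x) :=
    continuousAt_fst.prodMk ((φ.continuousAt_extend (I := I) hx).comp continuousAt_snd)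
  have h4 : Filter.Tendsto (fun p : P × M => (p.1, φ.extend I p.2)) (𝓝 (t, x))
      (𝓝[univ ×ˢ range I] (t, φ.extend I x)) :=
    tendsto_nhdsWithin_iff.2 ⟨h3, Filter.Eventually.of_forall fun p =>
      ⟨mem_univ _, mem_range_self _⟩⟩
  exact h2.tendsto.comp h4

theorem continuous_diffeo_of_contMDiff [IsManifold I ∞ M] {k : ℕ∞}
    {F : ℝ → M ≃ₘ^(k : WithTop ℕ∞)⟮I, I⟯ M}
    (hF : ContMDiff (𝓘(ℝ, ℝ).prod I) I k (fun p : ℝ × M => F p.1 p.2)) : Continuous F := by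
  refine continuous_generateFrom_iff.2 ?_
  rintro _ ⟨j, f, φ, ψ, K, ε, hj, hφ, hψ, hK, hKφ, hf, hε, rfl⟩
  rw [isOpen_iff_mem_nhds]
  rintro t ⟨ht1, ht2⟩
  have hFc : Continuous fun p : ℝ × M => F p.1 p.2 := hF.continuous
  have e1 : ∀ᶠ s in 𝓝 t, ∀ x ∈ K, F s x ∈ ψ.source := by
    refine hK.eventually_forall_of_forall_eventually fun x hx => ?_
    exact hFc.continuousAt (x := (t, x)) (ψ.open_source.mem_nhds (ht1 hx))
  have e2 : ∀ m ≤ j, ∀ᶠ s in 𝓝 t, ∀ x ∈ K,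
      ‖iteratedFDerivWithin ℝ m (ψ.extend I ∘ F s ∘ (φ.extend I).symm) (range I) (φ.extend I x) -
      iteratedFDerivWithin ℝ m (ψ.extend I ∘ f ∘ (φ.extend I).symm) (range I) (φ.extend I x)‖
        < ε := by
    intro m hm
    have hmk : (m : ℕ∞) ≤ k := by
      have : (j : ℕ∞) ≤ k := by exact_mod_cast hj
      exact le_trans (by exact_mod_cast hm) this
    refine hK.eventually_forall_of_forall_eventually fun x hx => ?_
    have c1 := continuousAt_iteratedFDerivWithin_localRep (F := fun s => F s) hF hφ hψ (hKφ hx) (ht1 hx) hmk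
    have hfF : ContMDiff (𝓘(ℝ, ℝ).prod I) I k (fun p : ℝ × M => f p.2) :=
      f.contMDiff.comp contMDiff_snd
    have c2 := continuousAt_iteratedFDerivWithin_localRep (F := fun _ : ℝ => (f : M → M))
      (t := t) hfF hφ hψ (hKφ hx) (hf hx) hmk
    exact (c1.sub c2).norm.eventually_lt_const (ht2 m hm x hx)
  have e2' : ∀ᶠ s in 𝓝 t, ∀ m ∈ Finset.range (j + 1), ∀ x ∈ K,
      ‖iteratedFDerivWithin ℝ m (ψ.extend I ∘ F s ∘ (φ.extend I).symm) (range I) (φ.extend I x) -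
      iteratedFDerivWithin ℝ m (ψ.extend I ∘ f ∘ (φ.extend I).symm) (range I) (φ.extend I x)‖
        < ε :=
    (Finset.eventually_all _).2 fun m hm => e2 m (Nat.lt_succ_iff.1 (Finset.mem_range.1 hm))
  filter_upwards [e1, e2'] with s h1 h2
  exact ⟨h1, fun m hm => h2 m (Finset.mem_range.2 (Nat.lt_succ_iff.2 hm))⟩

end CkTopology

end

noncomputable section

/-! ### Isotopies -/

section Isotopy

variable {E : Type*} [NormedAddCommGroup E] [NormedSpace ℝ E]
  {H : Type*} [TopologicalSpace H] (I : ModelWithCorners ℝ E H)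
  (M : Type*) [TopologicalSpace M] [ChartedSpace H M]

/-- The homeomorphisms that are isotopic to the identity, through diffeomorphisms if `M` is a
smooth manifold. -/
def isotopyGroup : Subgroup (M ≃ₜ M) where
  carrier := {g | (∃ F : ℝ → (M ≃ₜ M), Continuous (fun p : ℝ × M => F p.1 p.2) ∧
      F 0 = 1 ∧ F 1 = g) ∧
    (IsManifold I ∞ M → ∃ F : ℝ → (M ≃ₘ^∞⟮I, I⟯ M),
      ContMDiff (𝓘(ℝ, ℝ).prod I) I ∞ (fun p : ℝ × M => F p.1 p.2) ∧
      F 0 = 1 ∧ ∀ x, F 1 x = g x)}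
  mul_mem' := by
    rintro f g ⟨⟨F, hF, hF0, hF1⟩, hf⟩ ⟨⟨G, hG, hG0, hG1⟩, hg⟩
    refine ⟨⟨fun t => F t * G t, hF.comp (continuous_fst.prodMk hG), by simp [hF0, hG0],
      by simp [hF1, hG1]⟩, fun hM => ?_⟩
    obtain ⟨F, hF, hF0, hF1⟩ := hf hM
    obtain ⟨G, hG, hG0, hG1⟩ := hg hM
    refine ⟨fun t => F t * G t, hF.comp (contMDiff_fst.prodMk hG), by simp [hF0, hG0], fun x => ?_⟩
    rw [diffeo_mul_apply, hG1, hF1]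
    rfl
  one_mem' := by
    refine ⟨⟨fun _ => 1, continuous_snd, rfl, rfl⟩, fun hM => ?_⟩
    exact ⟨fun _ => 1, contMDiff_snd, rfl, fun _ => rfl⟩
  inv_mem' := by
    rintro g ⟨⟨G, hG, hG0, hG1⟩, hg⟩
    refine ⟨⟨fun t => G (1 - t) * g⁻¹, ?_, by simp [hG1], by simp [hG0]⟩, fun hM => ?_⟩
    · exact hG.comp ((continuous_const.sub continuous_fst).prodMk
        (g⁻¹.continuous.comp continuous_snd))
    obtain ⟨G, hG, hG0, hG1⟩ := hg hM
    refine ⟨fun t => G (1 - t) * (G 1)⁻¹, ?_, by simp, fun x => ?_⟩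
    · refine hG.comp (ContMDiff.prodMk ?_ ((G 1)⁻¹.contMDiff.comp contMDiff_snd))
      exact ((contDiff_const.sub contDiff_id).contMDiff (n := ∞)).comp contMDiff_fst
    · change (G (1 - 1) * (G 1)⁻¹) x = g⁻¹ x
      rw [sub_self, hG0, one_mul]
      apply (G 1).injective
      have h1 : G 1 (g.symm x) = x := by rw [hG1, g.apply_symm_apply]
      exact ((G 1).apply_symm_apply x).trans h1.symm

variable {I M}

theorem exists_diffeo_of_mem_isotopyGroup [IsManifold I ∞ M] {g : M ≃ₜ M}
    (hg : g ∈ isotopyGroup I M) :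
    ∃ f : M ≃ₘ^∞⟮I, I⟯ M, (∀ x, f x = g x) ∧ f ∈ diffeoZero I M ∞ ∧
      ∀ k : ℕ∞, smoothToCk k f ∈ diffeoZero I M k := by
  obtain ⟨F, hF, hF0, hF1⟩ := hg.2 inferInstance
  refine ⟨F 1, hF1, ?_, fun k => ?_⟩
  · have hc : Continuous F := continuous_diffeo_of_contMDiff (k := ⊤) hF
    exact (isPreconnected_range hc).subset_connectedComponent ⟨0, hF0⟩ ⟨1, rfl⟩
  · have hc : Continuous fun t => smoothToCk k (F t) :=
      continuous_diffeo_of_contMDiff (hF.of_le (by exact_mod_cast (le_top : k ≤ ⊤)))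
    refine (isPreconnected_range hc).subset_connectedComponent ⟨0, ?_⟩ ⟨1, rfl⟩
    simp only [hF0]
    rfl

end Isotopy

theorem mem_homeoZero_of_mem_isotopyGroup {E : Type*} [NormedAddCommGroup E] [NormedSpace ℝ E]
    {H : Type*} [TopologicalSpace H] {I : ModelWithCorners ℝ E H}
    {M : Type*} [MetricSpace M] [CompactSpace M] [ChartedSpace H M] {g : M ≃ₜ M}
    (hg : g ∈ isotopyGroup I M) : g ∈ homeoZero M := by
  obtain ⟨⟨F, hF, hF0, hF1⟩, -⟩ := hg
  have hc : Continuous F := by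
    refine continuous_induced_rng.2 ?_
    exact ContinuousMap.continuous_of_continuous_uncurry _ hF
  exact (isPreconnected_range hc).subset_connectedComponent ⟨0, hF0⟩ ⟨1, hF1⟩

/-! ### Perturbations of the identity, and their extension from a chart -/

section ChartMoves

variable {E : Type*} [NormedAddCommGroup E] [NormedSpace ℝ E]

theorem exists_homeomorph_add_smul [CompleteSpace E] {v : E → E} (hv : ContDiff ℝ ∞ v)
    (hlip : LipschitzWith (1 / 2) v) {s : ℝ} (hs : |s| ≤ 1) :
    ∃ k : E ≃ₜ E, (∀ z, k z = z + s • v z) ∧ ContDiff ℝ ∞ k.symm := by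
  have happ : ApproximatesLinearOn (fun z => z + s • v z)
      ((ContinuousLinearEquiv.refl ℝ E : E ≃L[ℝ] E) : E →L[ℝ] E) univ (1 / 2) := by
    intro x _ y _
    have : (x + s • v x) - (y + s • v y) -
        ((ContinuousLinearEquiv.refl ℝ E : E ≃L[ℝ] E) : E →L[ℝ] E) (x - y) = s • (v x - v y) := by
      simp only [ContinuousLinearEquiv.coe_refl, ContinuousLinearMap.coe_id', id_eq, smul_sub]
      abel
    rw [this, norm_smul, Real.norm_eq_abs]
    calc |s| * ‖v x - v y‖ ≤ 1 * ‖v x - v y‖ := by gcongr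
      _ ≤ _ := by rw [one_mul]; exact hlip.norm_sub_le x y
  have hc : Subsingleton E ∨ (1 / 2 : NNReal) <
      ‖((ContinuousLinearEquiv.refl ℝ E).symm : E →L[ℝ] E)‖₊⁻¹ := by
    rcases subsingleton_or_nontrivial E with h | h
    · exact Or.inl h
    · right
      have : ‖((ContinuousLinearEquiv.refl ℝ E).symm : E →L[ℝ] E)‖₊ = 1 := by
        ext
        exact ContinuousLinearMap.norm_id
      rw [this]
      norm_num
  have hkc : ContDiff ℝ ∞ (fun z => z + s • v z) := contDiff_id.add (contDiff_const.smul hv)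
  refine ⟨happ.toHomeomorph _ hc, fun z => rfl, ?_⟩
  have hnorm : ∀ a, ‖-(s • fderiv ℝ v a)‖ < 1 := by
    intro a
    rw [norm_neg, norm_smul, Real.norm_eq_abs]
    have h1 : ‖fderiv ℝ v a‖ ≤ (1 / 2 : NNReal) := norm_fderiv_le_of_lipschitz ℝ hlip
    push_cast at h1
    nlinarith [norm_nonneg (fderiv ℝ v a), abs_nonneg s]
  refine Homeomorph.contDiff_symm _
    (f₀' := fun a => ContinuousLinearEquiv.unitsEquiv ℝ E (Units.oneSub _ (hnorm a)))
    (fun a => ?_) hkc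
  have h2 : HasFDerivAt (fun z => z + s • v z)
      (ContinuousLinearMap.id ℝ E + s • fderiv ℝ v a) a :=
    (hasFDerivAt_id a).add (((hv.differentiable (by simp)) a).hasFDerivAt.const_smul s)
  have h3 : ((ContinuousLinearEquiv.unitsEquiv ℝ E (Units.oneSub _ (hnorm a)) : E ≃L[ℝ] E) :
      E →L[ℝ] E) = ContinuousLinearMap.id ℝ E + s • fderiv ℝ v a := by
    ext z
    simp
  rw [h3]
  exact h2

section

variable {E M : Type*}

open Classical in
/-- The self-map of a manifold that is `k` in a chart and the identity elsewhere. -/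
def chartExtend (Φ : PartialEquiv M E) (k : E → E) (x : M) : M :=
  if x ∈ Φ.source then Φ.symm (k (Φ x)) else x

theorem chartExtend_of_mem {Φ : PartialEquiv M E} {k : E → E} {x : M} (hx : x ∈ Φ.source) :
    chartExtend Φ k x = Φ.symm (k (Φ x)) := if_pos hx

theorem chartExtend_of_notMem {Φ : PartialEquiv M E} {k : E → E} {T : Set E}
    (hk : ∀ z ∉ T, k z = z) {x : M} (hx : x ∉ Φ.symm '' T) :
    chartExtend Φ k x = x := by
  by_cases h : x ∈ Φ.source
  · rw [chartExtend_of_mem h, hk, Φ.left_inv h]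
    exact fun h' => hx ⟨_, h', Φ.left_inv h⟩
  · exact if_neg h

theorem chartExtend_comp {Φ : PartialEquiv M E} {k l : E → E} (hl : MapsTo l Φ.target Φ.target)
    (hkl : ∀ z, k (l z) = z) (x : M) : chartExtend Φ k (chartExtend Φ l x) = x := by
  by_cases h : x ∈ Φ.source
  · have h1 : l (Φ x) ∈ Φ.target := hl (Φ.map_source h)
    rw [chartExtend_of_mem h, chartExtend_of_mem (Φ.map_target h1), Φ.right_inv h1, hkl,
      Φ.left_inv h]
  · have h1 : ∀ k, chartExtend Φ k x = x := fun k => if_neg h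
    rw [h1, h1]

theorem mapsTo_of_injective_of_eqOn_compl {k : E → E} {T S : Set E} (hk : Function.Injective k)
    (hT : ∀ z ∉ T, k z = z) (hTS : T ⊆ S) : MapsTo k S S := by
  intro z hz
  by_cases h : k z ∈ T
  · exact hTS h
  · have := hk (hT _ h)
    rwa [this]

end

variable {H : Type*} [TopologicalSpace H] {I : ModelWithCorners ℝ E H}
  {M : Type*} [TopologicalSpace M]

theorem continuous_chartExtend [T2Space M] {P : Type*} [TopologicalSpace P]
    {e : OpenPartialHomeomorph M H}
    {T : Set E} (hT : IsCompact T) (hTe : T ⊆ (e.extend I).target) {κ : P → E → E}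
    (hκ : Continuous fun p : P × E => κ p.1 p.2) (hinj : ∀ t, Function.Injective (κ t))
    (hid : ∀ t, ∀ z ∉ T, κ t z = z) :
    Continuous fun p : P × M => chartExtend (e.extend I) (κ p.1) p.2 := by
  have hmaps := fun t => mapsTo_of_injective_of_eqOn_compl (hinj t) (hid t) hTe
  rw [continuous_iff_continuousAt]
  rintro ⟨t, x⟩
  by_cases hx : x ∈ e.source
  · have hxs : x ∈ (e.extend I).source := by rwa [e.extend_source]
    have hev : ∀ᶠ p : P × M in 𝓝 (t, x), p.2 ∈ (e.extend I).source :=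
      continuousAt_snd (e.isOpen_extend_source.mem_nhds hxs)
    have h0 : ContinuousAt (fun p : P × M => (p.1, e.extend I p.2)) (t, x) :=
      continuousAt_fst.prodMk (ContinuousAt.comp (f := Prod.snd) (x := (t, x))
        (e.continuousAt_extend (I := I) hx) continuousAt_snd)
    have h1 : ContinuousAt (fun p : P × M => κ p.1 (e.extend I p.2)) (t, x) :=
      ContinuousAt.comp (g := fun p : P × E => κ p.1 p.2) hκ.continuousAt h0
    have h2 : ContinuousWithinAt (e.extend I).symm (e.extend I).target (κ t (e.extend I x)) :=
      (e.continuousOn_extend_symm) _ (hmaps t ((e.extend I).map_source hxs))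
    have h3 : ContinuousAt (fun p : P × M => (e.extend I).symm (κ p.1 (e.extend I p.2))) (t, x) :=
      h2.tendsto.comp (tendsto_nhdsWithin_iff.2 ⟨h1, hev.mono fun p hp =>
        hmaps p.1 ((e.extend I).map_source hp)⟩)
    exact h3.congr (hev.mono fun p hp => (chartExtend_of_mem hp).symm)
  · have hcl : IsClosed ((e.extend I).symm '' T) :=
      (hT.image_of_continuousOn (e.continuousOn_extend_symm.mono hTe)).isClosed
    have hx' : x ∈ ((e.extend I).symm '' T)ᶜ := by
      rintro ⟨z, hz, rfl⟩
      exact hx (by simpa using (e.extend I).map_target (hTe hz))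
    have hev : ∀ᶠ p : P × M in 𝓝 (t, x), p.2 ∈ ((e.extend I).symm '' T)ᶜ :=
      continuousAt_snd (hcl.isOpen_compl.mem_nhds hx')
    exact continuousAt_snd.congr (hev.mono fun p hp => (chartExtend_of_notMem (hid p.1) hp).symm)

variable [ChartedSpace H M]

theorem contMDiff_chartExtend [T2Space M] [IsManifold I ∞ M] {P : Type*} [NormedAddCommGroup P]
    [NormedSpace ℝ P] {e : OpenPartialHomeomorph M H} (he : e ∈ IsManifold.maximalAtlas I ∞ M)
    {T : Set E} (hT : IsCompact T) (hTe : T ⊆ (e.extend I).target) {κ : P → E → E}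
    (hκ : ContDiff ℝ ∞ fun p : P × E => κ p.1 p.2) (hinj : ∀ t, Function.Injective (κ t))
    (hid : ∀ t, ∀ z ∉ T, κ t z = z) :
    ContMDiff (𝓘(ℝ, P).prod I) I ∞ fun p : P × M => chartExtend (e.extend I) (κ p.1) p.2 := by
  have hmaps := fun t => mapsTo_of_injective_of_eqOn_compl (hinj t) (hid t) hTe
  rintro ⟨t, x⟩
  by_cases hx : x ∈ e.source
  · have hxs : x ∈ (e.extend I).source := by rwa [e.extend_source]
    have hev : ∀ᶠ p : P × M in 𝓝 (t, x), p.2 ∈ (e.extend I).source :=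
      continuousAt_snd (e.isOpen_extend_source.mem_nhds hxs)
    have h1 : ContMDiffAt (𝓘(ℝ, P).prod I) 𝓘(ℝ, E) ∞
        (fun p : P × M => κ p.1 (e.extend I p.2)) (t, x) := by
      have h0 : ContMDiffAt (𝓘(ℝ, P).prod I) 𝓘(ℝ, P × E) ∞
          (fun p : P × M => (p.1, e.extend I p.2)) (t, x) :=
        contMDiffAt_fst.prodMk_space
          (ContMDiffAt.comp (t, x) (e.contMDiffAt_extend he hx) contMDiffAt_snd)
      exact hκ.contMDiff.contMDiffAt.comp (t, x) h0
    have h2 : ContMDiffWithinAt 𝓘(ℝ, E) I ∞ (e.extend I).symm (e.extend I).target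
        (κ t (e.extend I x)) := by
      have := contMDiffOn_extend_symm he
      rw [← e.extend_target'] at this
      exact this _ (hmaps t ((e.extend I).map_source hxs))
    have h3 : ContMDiffAt (𝓘(ℝ, P).prod I) I ∞
        (fun p : P × M => (e.extend I).symm (κ p.1 (e.extend I p.2))) (t, x) := by
      refine ContMDiffWithinAt.contMDiffAt (s := Prod.snd ⁻¹' (e.extend I).source) ?_ hev
      exact ContMDiffWithinAt.comp (t, x) h2 h1.contMDiffWithinAt
        fun p hp => hmaps p.1 ((e.extend I).map_source hp)
    exact h3.congr_of_eventuallyEq (hev.mono fun p hp => (chartExtend_of_mem hp))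
  · have hcl : IsClosed ((e.extend I).symm '' T) :=
      (hT.image_of_continuousOn (e.continuousOn_extend_symm.mono hTe)).isClosed
    have hx' : x ∈ ((e.extend I).symm '' T)ᶜ := by
      rintro ⟨z, hz, rfl⟩
      exact hx (by simpa using (e.extend I).map_target (hTe hz))
    have hev : ∀ᶠ p : P × M in 𝓝 (t, x), p.2 ∈ ((e.extend I).symm '' T)ᶜ :=
      continuousAt_snd (hcl.isOpen_compl.mem_nhds hx')
    exact contMDiffAt_snd.congr_of_eventuallyEq
      (hev.mono fun p hp => (chartExtend_of_notMem (hid p.1) hp))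

theorem exists_isotopy_of_vectorField [CompleteSpace E] [T2Space M]
    {e : OpenPartialHomeomorph M H} (he : e ∈ atlas H M)
    {T : Set E} (hT : IsCompact T) (hTe : T ⊆ (e.extend I).target) {v : E → E}
    (hv : ContDiff ℝ ∞ v) (hlip : LipschitzWith (1 / 2) v) (hvT : ∀ z ∉ T, v z = 0) :
    ∃ g ∈ isotopyGroup I M,
      (∀ x ∈ e.source, g x = (e.extend I).symm (e.extend I x + v (e.extend I x))) ∧
      ∀ x ∉ (e.extend I).symm '' T, g x = x := by
  have hs : ∀ t : ℝ, |Real.sin (t * (Real.pi / 2))| ≤ 1 := fun t => Real.abs_sin_le_one _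
  choose k hk hksymm using fun t => exists_homeomorph_add_smul hv hlip (hs t)
  have hid : ∀ t, ∀ z ∉ T, k t z = z := fun t z hz => by rw [hk, hvT z hz, smul_zero, add_zero]
  have hid' : ∀ t, ∀ z ∉ T, (k t).symm z = z := fun t z hz =>
    (k t).symm_apply_eq.2 (hid t z hz).symm
  have hκ : ContDiff ℝ ∞ fun p : ℝ × E => k p.1 p.2 := by
    simp only [hk]
    exact contDiff_snd.add (((Real.contDiff_sin.comp
      (contDiff_fst.mul contDiff_const))).smul (hv.comp contDiff_snd))
  have hκ' : ∀ t, ContDiff ℝ ∞ fun p : ℝ × E => (k t).symm p.2 := fun t =>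
    (hksymm t).comp contDiff_snd
  have hmaps := fun t => mapsTo_of_injective_of_eqOn_compl (k t).injective (hid t) hTe
  have hmaps' := fun t => mapsTo_of_injective_of_eqOn_compl (k t).symm.injective (hid' t) hTe
  have hcont : Continuous fun p : ℝ × M => chartExtend (e.extend I) (k p.1) p.2 :=
    continuous_chartExtend hT hTe (κ := fun t => k t) hκ.continuous (fun t => (k t).injective) hid
  have hcont' : ∀ t, Continuous fun p : ℝ × M => chartExtend (e.extend I) (k t).symm p.2 :=
    fun t => continuous_chartExtend hT hTe (κ := fun _ => (k t).symm) (hκ' t).continuous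
      (fun _ => (k t).symm.injective) (fun _ => hid' t)
  have hleft : ∀ t x, chartExtend (e.extend I) (k t).symm (chartExtend (e.extend I) (k t) x) = x :=
    fun t => chartExtend_comp (hmaps t) (k t).symm_apply_apply
  have hright : ∀ t x, chartExtend (e.extend I) (k t) (chartExtend (e.extend I) (k t).symm x) = x :=
    fun t => chartExtend_comp (hmaps' t) (k t).apply_symm_apply
  let Q : ℝ → (M ≃ M) := fun t => ⟨_, _, hleft t, hright t⟩
  let F : ℝ → (M ≃ₜ M) := fun t => ⟨Q t, hcont.comp (continuous_const.prodMk continuous_id),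
    (hcont' t).comp ((continuous_const (y := (0 : ℝ))).prodMk continuous_id)⟩
  have hk0 : ∀ z, k 0 z = z := fun z => by simp [hk]
  have hzero : ∀ x, chartExtend (e.extend I) (k 0) x = x := fun x =>
    chartExtend_of_notMem (T := ∅) (fun z _ => hk0 z) (by simp)
  refine ⟨F 1, ⟨⟨F, hcont, Homeomorph.ext hzero, rfl⟩, fun hM => ?_⟩, fun x hx => ?_,
    fun x hx => chartExtend_of_notMem (hid 1) hx⟩
  · have hmax : e ∈ IsManifold.maximalAtlas I ∞ M := IsManifold.subset_maximalAtlas he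
    have hsm : ContMDiff (𝓘(ℝ, ℝ).prod I) I ∞
        fun p : ℝ × M => chartExtend (e.extend I) (k p.1) p.2 :=
      contMDiff_chartExtend hmax hT hTe (κ := fun t => k t) hκ (fun t => (k t).injective) hid
    have hsm' : ∀ t, ContMDiff (𝓘(ℝ, ℝ).prod I) I ∞
        fun p : ℝ × M => chartExtend (e.extend I) (k t).symm p.2 :=
      fun t => contMDiff_chartExtend hmax hT hTe (κ := fun _ => (k t).symm) (hκ' t)
        (fun _ => (k t).symm.injective) (fun _ => hid' t)
    exact ⟨fun t => ⟨Q t, hsm.comp (contMDiff_const.prodMk contMDiff_id),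
      (hsm' t).comp ((contMDiff_const (c := (0 : ℝ))).prodMk contMDiff_id)⟩, hsm,
      Diffeomorph.ext hzero, fun _ => rfl⟩
  · change chartExtend (e.extend I) (k 1) x = _
    rw [chartExtend_of_mem (by rwa [e.extend_source]), hk]
    simp

end ChartMoves

end

noncomputable section

/-! ### Local homogeneity of the interior -/

section LocalHomogeneity

variable {E : Type*} [NormedAddCommGroup E] [NormedSpace ℝ E]
  {H : Type*} [TopologicalSpace H] (I : ModelWithCorners ℝ E H)
  (M : Type*) [TopologicalSpace M] [ChartedSpace H M]

/-- The points that some chart of the atlas maps to an interior point of its image. -/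
def interiorPts : Set M :=
  {x | ∃ e ∈ atlas H M, x ∈ e.source ∧ e.extend I x ∈ interior (e.extend I).target}

theorem isOpen_interiorPts : IsOpen (interiorPts I M) := by
  rw [isOpen_iff_mem_nhds]
  rintro x ⟨e, he, hx, hi⟩
  filter_upwards [e.open_source.mem_nhds hx,
    e.continuousAt_extend hx (isOpen_interior.mem_nhds hi)] with y hy hy'
  exact ⟨e, he, hy, hy'⟩

variable {I M}

theorem exists_closedBall_subset_target {x : M} (hx : x ∈ interiorPts I M) {W : Set M}
    (hW : W ∈ 𝓝 x) : ∃ e ∈ atlas H M, x ∈ e.source ∧ ∃ R : ℝ, 0 < R ∧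
      Metric.closedBall (e.extend I x) R ⊆ (e.extend I).target ∧
      MapsTo (e.extend I).symm (Metric.closedBall (e.extend I x) R) W := by
  obtain ⟨e, he, hx, hi⟩ := hx
  have h1 : (e.extend I).symm ⁻¹' W ∈ 𝓝 (e.extend I x) := e.extend_preimage_mem_nhds hx hW
  have h2 := Filter.inter_mem (mem_interior_iff_mem_nhds.1 hi) h1
  obtain ⟨R, hR, hsub⟩ := Metric.nhds_basis_closedBall.mem_iff.1 h2
  exact ⟨e, he, hx, R, hR, fun z hz => (hsub hz).1, fun z hz => (hsub hz).2⟩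

variable [FiniteDimensional ℝ E]

theorem exists_translation_vectorField (c : E) {R : ℝ} (hR : 0 < R) :
    ∃ r : ℝ, 0 < r ∧ r ≤ R ∧ ∀ y ∈ Metric.ball c r, ∀ y' ∈ Metric.ball c r, ∃ v : E → E,
      ContDiff ℝ ∞ v ∧ LipschitzWith (1 / 2) v ∧ (∀ z ∉ Metric.closedBall c R, v z = 0) ∧
      y + v y = y' := by
  let χ : ContDiffBump c := ⟨R / 2, R, half_pos hR, half_lt_self hR⟩
  obtain ⟨C, hC⟩ := (χ.contDiff (n := 1)).lipschitzWith_of_hasCompactSupport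
    χ.hasCompactSupport (by simp)
  refine ⟨min (R / 2) (1 / (4 * (C + 1))), by positivity,
    (min_le_left _ _).trans (half_le_self hR.le), fun y hy y' hy' =>
    ⟨fun z => χ z • (y' - y), χ.contDiff.smul contDiff_const, ?_, fun z hz => ?_, ?_⟩⟩
  · refine LipschitzWith.of_dist_le_mul fun z z' => ?_
    rw [dist_eq_norm, ← sub_smul, norm_smul]
    have h1 : ‖χ z - χ z'‖ ≤ C * dist z z' := by
      rw [← dist_eq_norm]; exact hC.dist_le_mul z z'
    have h2 : ‖y' - y‖ ≤ 1 / (2 * (C + 1)) := by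
      rw [← dist_eq_norm]
      have h3 := (Metric.mem_ball.1 hy).trans_le (min_le_right _ _)
      have h4 := (Metric.mem_ball.1 hy').trans_le (min_le_right _ _)
      have h5 : (1 : ℝ) / (2 * (C + 1)) = 1 / (4 * (C + 1)) + 1 / (4 * (C + 1)) := by
        field_simp; norm_num
      rw [h5]
      exact (dist_triangle_right y' y c).trans (add_le_add h4.le h3.le)
    calc ‖χ z - χ z'‖ * ‖y' - y‖ ≤ (C * dist z z') * (1 / (2 * (C + 1))) := by gcongr
      _ = (C / (C + 1)) * (1 / 2) * dist z z' := by field_simp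
      _ ≤ 1 * (1 / 2) * dist z z' := by
        gcongr
        rw [div_le_one (by positivity)]
        linarith
      _ = _ := by push_cast; ring
  · have : z ∉ Function.support χ := by
      rw [χ.support_eq]
      exact fun h => hz (Metric.ball_subset_closedBall h)
    simp [Function.notMem_support.1 this]
  · have : χ y = 1 := χ.one_of_mem_closedBall
      (Metric.ball_subset_closedBall (Metric.ball_subset_ball (min_le_left _ _) hy))
    simp [this]

theorem exists_contraction_vectorField (c : E) {R : ℝ} (hR : 0 < R) :
    ∃ ε : ℝ, 0 < ε ∧ ε < 1 ∧ ∃ v : E → E,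
      ContDiff ℝ ∞ v ∧ LipschitzWith (1 / 2) v ∧ (∀ z ∉ Metric.closedBall c R, v z = 0) ∧
      ∀ z ∈ Metric.closedBall c (R / 2), v z = -(ε • (z - c)) := by
  let χ : ContDiffBump c := ⟨R / 2, R, half_pos hR, half_lt_self hR⟩
  have hw : ContDiff ℝ ∞ fun z => χ z • (z - c) :=
    χ.contDiff.smul (contDiff_id.sub contDiff_const)
  have hws : HasCompactSupport fun z => χ z • (z - c) := χ.hasCompactSupport.smul_right
  obtain ⟨C, hC⟩ := hw.lipschitzWith_of_hasCompactSupport hws (by simp)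
  have hε1 : 1 / (2 * ((C : ℝ) + 1)) < 1 := by
    rw [div_lt_one (by positivity)]
    have := C.2
    linarith [NNReal.coe_nonneg C]
  refine ⟨1 / (2 * (C + 1)), by positivity, hε1,
    fun z => -((1 / (2 * ((C : ℝ) + 1))) • (χ z • (z - c))), (contDiff_const.smul hw).neg, ?_,
    fun z hz => ?_, fun z hz => ?_⟩
  · refine LipschitzWith.of_dist_le_mul fun z z' => ?_
    rw [dist_neg_neg, dist_smul₀]
    have h1 := hC.dist_le_mul z z'
    rw [Real.norm_of_nonneg (by positivity)]
    calc _ ≤ (1 / (2 * ((C : ℝ) + 1))) * (C * dist z z') := by gcongr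
      _ = (C / (C + 1)) * (1 / 2) * dist z z' := by field_simp
      _ ≤ 1 * (1 / 2) * dist z z' := by
        gcongr
        rw [div_le_one (by positivity)]
        linarith
      _ = _ := by push_cast; ring
  · have : z ∉ Function.support χ := by
      rw [χ.support_eq]
      exact fun h => hz (Metric.ball_subset_closedBall h)
    simp [Function.notMem_support.1 this]
  · have : χ z = 1 := χ.one_of_mem_closedBall hz
    simp only [this, one_smul]

/-- Small open sets around an interior point are homogeneous, by isotopies supported nearby. -/
theorem exists_locally_transitive [T2Space M] {x : M} (hx : x ∈ interiorPts I M) {W : Set M}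
    (hW : W ∈ 𝓝 x) : ∃ O : Set M, IsOpen O ∧ x ∈ O ∧ O ⊆ W ∧ ∀ y ∈ O, ∀ y' ∈ O,
      ∃ g ∈ isotopyGroup I M, g y = y' ∧ ∀ z ∉ W, g z = z := by
  obtain ⟨e, he, hxe, R, hR, hRt, hRW⟩ := exists_closedBall_subset_target hx hW
  obtain ⟨r, hr, hrR, hv⟩ := exists_translation_vectorField (e.extend I x) hR
  have hsym : ∀ y ∈ e.source, e.extend I y ∈ Metric.ball (e.extend I x) r → y ∈ W := by
    intro y hy hy'
    have := hRW (Metric.ball_subset_closedBall (Metric.ball_subset_ball hrR hy'))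
    rwa [e.extend_left_inv hy] at this
  refine ⟨e.source ∩ e.extend I ⁻¹' Metric.ball (e.extend I x) r,
    ?_, ⟨hxe, Metric.mem_ball_self hr⟩, fun y hy => hsym y hy.1 hy.2, ?_⟩
  · have := e.continuousOn_extend (I := I)
    exact (this.mono e.extend_source.ge).isOpen_inter_preimage e.open_source Metric.isOpen_ball
  rintro y ⟨hy, hyb⟩ y' ⟨hy', hyb'⟩
  obtain ⟨v, hvs, hvl, hv0, hvy⟩ := hv _ hyb _ hyb'
  obtain ⟨g, hg, hg1, hg2⟩ := exists_isotopy_of_vectorField he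
    (isCompact_closedBall _ _) hRt hvs hvl hv0
  refine ⟨g, hg, ?_, fun z hz => hg2 z ?_⟩
  · rw [hg1 y hy, hvy, e.extend_left_inv hy']
  · rintro ⟨u, hu, rfl⟩
    exact hz (hRW hu)

/-- Every interior point has a neighbourhood that can be shrunk to the point. -/
theorem exists_shrinkable_nhds [T2Space M] {x : M} (hx : x ∈ interiorPts I M) {W : Set M}
    (hW : W ∈ 𝓝 x) : ∃ Y ∈ 𝓝 x, Y ⊆ W ∧ ∀ X ∈ 𝓝 x,
      ∃ g ∈ isotopyGroup I M, MapsTo g Y X ∧ ∀ z ∉ W, g z = z := by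
  obtain ⟨e, he, hxe, R, hR, hRt, hRW⟩ := exists_closedBall_subset_target hx hW
  obtain ⟨ε, hε, hε1, v, hvs, hvl, hv0, hv⟩ := exists_contraction_vectorField (e.extend I x) hR
  obtain ⟨g, hg, hg1, hg2⟩ := exists_isotopy_of_vectorField he
    (isCompact_closedBall _ _) hRt hvs hvl hv0
  have hball : Metric.ball (e.extend I x) (R / 2) ⊆ Metric.closedBall (e.extend I x) R :=
    Metric.ball_subset_closedBall.trans (Metric.closedBall_subset_closedBall (half_le_self hR.le))
  refine ⟨e.source ∩ e.extend I ⁻¹' Metric.ball (e.extend I x) (R / 2), ?_, ?_, fun X hX => ?_⟩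
  · exact Filter.inter_mem (e.open_source.mem_nhds hxe)
      (e.continuousAt_extend hxe (Metric.ball_mem_nhds _ (half_pos hR)))
  · rintro y ⟨hy, hy'⟩
    have := hRW (hball hy')
    rwa [e.extend_left_inv hy] at this
  have hiter : ∀ (m : ℕ) (y : M), y ∈ e.source →
      e.extend I y ∈ Metric.ball (e.extend I x) (R / 2) →
      (g ^ m) y ∈ e.source ∧ e.extend I ((g ^ m) y) =
        e.extend I x + (1 - ε) ^ m • (e.extend I y - e.extend I x) := by
    intro m y hy hyb
    induction m with
    | zero => simp [hy]
    | succ m ih =>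
      have hb : e.extend I x + (1 - ε) ^ m • (e.extend I y - e.extend I x) ∈
          Metric.ball (e.extend I x) (R / 2) := by
        rw [Metric.mem_ball, dist_eq_norm] at hyb ⊢
        rw [add_sub_cancel_left, norm_smul, Real.norm_of_nonneg (pow_nonneg (by linarith) _)]
        refine lt_of_le_of_lt ?_ hyb
        exact mul_le_of_le_one_left (norm_nonneg _) (pow_le_one₀ (by linarith) (by linarith))
      have hb' : e.extend I x + (1 - ε) ^ (m + 1) • (e.extend I y - e.extend I x) ∈
          (e.extend I).target := by
        apply hRt
        apply hball
        rw [Metric.mem_ball, dist_eq_norm] at hyb ⊢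
        rw [add_sub_cancel_left, norm_smul, Real.norm_of_nonneg (pow_nonneg (by linarith) _)]
        refine lt_of_le_of_lt ?_ hyb
        exact mul_le_of_le_one_left (norm_nonneg _) (pow_le_one₀ (by linarith) (by linarith))
      have h1 : (g ^ (m + 1)) y = (e.extend I).symm
          (e.extend I x + (1 - ε) ^ (m + 1) • (e.extend I y - e.extend I x)) := by
        rw [pow_succ']
        change g ((g ^ m) y) = _
        rw [hg1 _ ih.1, ih.2, hv _ (Metric.ball_subset_closedBall hb)]
        congr 1
        rw [add_sub_cancel_left, pow_succ', mul_smul, sub_smul, one_smul]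
        abel
      rw [h1]
      exact ⟨by simpa using (e.extend I).map_target hb', (e.extend I).right_inv hb'⟩
  have hX' : (e.extend I).symm ⁻¹' X ∈ 𝓝 (e.extend I x) := e.extend_preimage_mem_nhds hxe hX
  obtain ⟨δ, hδ, hδX⟩ := Metric.mem_nhds_iff.1 hX'
  obtain ⟨m, hm⟩ := exists_pow_lt_of_lt_one (div_pos hδ (half_pos hR)) (by linarith : 1 - ε < 1)
  refine ⟨g ^ m, pow_mem hg m, ?_, ?_⟩
  · rintro y ⟨hy, hyb⟩
    obtain ⟨h1, h2⟩ := hiter m y hy hyb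
    rw [← e.extend_left_inv (I := I) h1, h2]
    apply hδX
    have hyb' := hyb
    rw [mem_preimage, Metric.mem_ball, dist_eq_norm] at hyb'
    rw [Metric.mem_ball, dist_eq_norm, add_sub_cancel_left, norm_smul,
      Real.norm_of_nonneg (pow_nonneg (by linarith) _)]
    calc (1 - ε) ^ m * ‖e.extend I y - e.extend I x‖ ≤ (1 - ε) ^ m * (R / 2) := by
          gcongr
      _ < δ / (R / 2) * (R / 2) := by gcongr
      _ = δ := by field_simp
  · intro z hz
    have hgz : g z = z := by
      apply hg2
      rintro ⟨u, hu, rfl⟩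
      exact hz (hRW hu)
    clear hm hiter
    induction m with
    | zero => rfl
    | succ m ih =>
      rw [pow_succ']
      change g ((g ^ m) z) = z
      rw [ih, hgz]

end LocalHomogeneity

end

noncomputable section

/-! ### Engulfing -/

section Engulfing

variable {M : Type*} [TopologicalSpace M]

/-- `Γ` acts transitively on small neighbourhoods of the points of `N`, with small supports. -/
def LocallyTransitiveOn (Γ : Subgroup (M ≃ₜ M)) (N : Set M) : Prop :=
  ∀ x ∈ N, ∀ W ∈ 𝓝 x, ∃ O : Set M, IsOpen O ∧ x ∈ O ∧ ∀ y ∈ O, ∀ y' ∈ O,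
    ∃ g ∈ Γ, g y = y' ∧ ∀ z ∉ W, g z = z

theorem LocallyTransitiveOn.exists_engulf [T1Space M] {Γ : Subgroup (M ≃ₜ M)} {N : Set M}
    (hΓ : LocallyTransitiveOn Γ N) (hN : IsPreconnected N) {U : Set M} (hU : IsOpen U)
    (hUN : (U ∩ N).Nonempty) {F : Set M} (hF : F.Finite) (hFN : F ⊆ N) :
    ∃ g ∈ Γ, ∀ x ∈ F, g x ∈ U := by
  induction F, hF using Set.Finite.induction_on with
  | empty => exact ⟨1, one_mem Γ, by simp⟩
  | @insert p F hp hF ih =>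
    obtain ⟨hpN, hFN⟩ := insert_subset_iff.1 hFN
    obtain ⟨g₀, hg₀, hg₀F⟩ := ih hFN
    let S : Set M := {x | ∃ g ∈ Γ, (∀ y ∈ F, g y ∈ U) ∧ g x ∈ U}
    have hS : IsOpen S := by
      have : S = ⋃ g ∈ {g ∈ Γ | ∀ y ∈ F, g y ∈ U}, g ⁻¹' U := by
        ext x
        simp [S, and_assoc]
      rw [this]
      exact isOpen_biUnion fun g _ => hU.preimage g.continuous
    have hne : (N ∩ S).Nonempty := by
      rcases F.eq_empty_or_nonempty with rfl | ⟨y, hy⟩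
      · obtain ⟨x, hxU, hxN⟩ := hUN
        exact ⟨x, hxN, 1, one_mem Γ, by simp, hxU⟩
      · exact ⟨y, hFN hy, g₀, hg₀, hg₀F, hg₀F y hy⟩
    have hsub : N ⊆ S := by
      refine hN.subset_of_closure_inter_subset hS hne ?_
      rintro x ⟨hx, hxN⟩
      by_cases hxF : x ∈ F
      · exact ⟨g₀, hg₀, hg₀F, hg₀F x hxF⟩
      · obtain ⟨O, hO, hxO, htr⟩ := hΓ x hxN Fᶜ (hF.isClosed.isOpen_compl.mem_nhds hxF)
        obtain ⟨y, hyO, g, hg, hgF, hgy⟩ := mem_closure_iff.1 hx O hO hxO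
        obtain ⟨h, hh, hxy, hhF⟩ := htr x hxO y hyO
        refine ⟨g * h, mul_mem hg hh, fun z hz => ?_, ?_⟩
        · change g (h z) ∈ U
          rw [hhF z (by simpa using hz)]
          exact hgF z hz
        · change g (h x) ∈ U
          rwa [hxy]
    obtain ⟨g, hg, hgF, hgp⟩ := hsub hpN
    exact ⟨g, hg, by simpa using ⟨hgp, hgF⟩⟩

end Engulfing

/-! ### Construction of the ping-pong table -/

section Table

variable {M : Type*} {n : ℕ}

/-- The conditions on the `i`-th generator of a ping-pong table, in a form that is stable under
perturbation. -/
def IsPingPong [TopologicalSpace M] (X : Option (Fin n × Bool) → Set M) (i : Fin n) (φ : M → M) :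
    Prop :=
  ∀ j, (j ≠ some (i, false) → MapsTo φ (X j) (interior (X (some (i, true))))) ∧
    (j ≠ some (i, true) → MapsTo φ (interior (X (some (i, false))))ᶜ (X j)ᶜ)

theorem isOpen_isPingPong [TopologicalSpace M] [CompactSpace M] [T2Space M] {G : Type*}
    [TopologicalSpace G] {ρ : G → M → M}
    (hopen : ∀ K O : Set M, IsCompact K → IsOpen O → IsOpen {g | MapsTo (ρ g) K O})
    {X : Option (Fin n × Bool) → Set M} (hX : ∀ j, IsCompact (X j)) (i : Fin n) :
    IsOpen {g | IsPingPong X i (ρ g)} := by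
  have : {g | IsPingPong X i (ρ g)} = ⋂ j,
      ({g | j ≠ some (i, false) → MapsTo (ρ g) (X j) (interior (X (some (i, true))))} ∩
       {g | j ≠ some (i, true) → MapsTo (ρ g) (interior (X (some (i, false))))ᶜ (X j)ᶜ}) := by
    ext g
    simp [IsPingPong]
  rw [this]
  refine isOpen_iInter_of_finite fun j => IsOpen.inter ?_ ?_
  · by_cases h : j ≠ some (i, false)
    · simpa [h] using hopen _ _ (hX j) isOpen_interior
    · simp [h]
  · by_cases h : j ≠ some (i, true)
    · simpa only [h, ne_eq, not_false_eq_true, forall_true_left] using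
        hopen _ _ isOpen_interior.isClosed_compl.isCompact (hX j).isClosed.isOpen_compl
    · simp [h]

theorem generatesDiscreteFree_of_isPingPong [TopologicalSpace M] [T2Space M] {G : Type*} [Group G]
    [TopologicalSpace G] (ρ : G →* Equiv.Perm M) (hcont : ∀ g, Continuous (ρ g))
    (hopen : ∀ K O : Set M, IsCompact K → IsOpen O → IsOpen {g | MapsTo (ρ g) K O})
    {X : Option (Fin n × Bool) → Set M} (hX : ∀ j, IsCompact (X j)) {q : M} (hq : q ∈ X none)
    (hq' : ∀ a, q ∉ X (some a)) {g : Fin n → G} (hg : ∀ i, IsPingPong X i (ρ (g i))) :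
    GeneratesDiscreteFree g := by
  refine generatesDiscreteFree_of_pingPong ρ hcont
    (fun x O hO => by simpa using hopen {x} O isCompact_singleton hO)
    (fun a => (hX _).isClosed) ?_ hq hq'
  rintro ⟨i, b⟩ j hj
  cases b with
  | true =>
    exact fun x hx => interior_subset ((hg i j).1 (by simpa using hj) hx)
  | false =>
    intro x hx
    by_contra hx'
    refine (hg i j).2 (by simpa using hj) (fun h => hx' (interior_subset h)) ?_
    simpa [map_inv] using hx

variable {E : Type*} [NormedAddCommGroup E] [NormedSpace ℝ E] [FiniteDimensional ℝ E]
  {H : Type*} [TopologicalSpace H] {I : ModelWithCorners ℝ E H}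
  [TopologicalSpace M] [ChartedSpace H M] [T2Space M]

theorem locallyTransitiveOn_isotopyGroup : LocallyTransitiveOn (isotopyGroup I M)
    (interiorPts I M) := by
  intro x hx W hW
  obtain ⟨O, hO, hxO, -, h⟩ := exists_locally_transitive hx hW
  exact ⟨O, hO, hxO, h⟩

/-- An isotopy that is the identity near `r` and moves finitely many points of `V` into `U`. -/
theorem exists_engulf_away_from {V : Set M} (hV : V ⊆ interiorPts I M) {r : M}
    (hVr : IsPreconnected (V \ {r})) {U : Set M} (hU : IsOpen U) (hUV : (U ∩ (V \ {r})).Nonempty)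
    {F : Set M} (hF : F.Finite) (hFV : F ⊆ V \ {r}) :
    ∃ g ∈ isotopyGroup I M, (∀ᶠ z in 𝓝 r, g z = z) ∧ ∀ x ∈ F, g x ∈ U := by
  let Γ : Subgroup (M ≃ₜ M) :=
    { carrier := {g | g ∈ isotopyGroup I M ∧ ∀ᶠ z in 𝓝 r, g z = z}
      mul_mem' := by
        rintro f g ⟨hf, hf'⟩ ⟨hg, hg'⟩
        refine ⟨mul_mem hf hg, ?_⟩
        filter_upwards [hf', hg'] with z h1 h2
        change f (g z) = z
        rw [h2, h1]
      one_mem' := ⟨one_mem _, Filter.Eventually.of_forall fun _ => rfl⟩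
      inv_mem' := by
        rintro g ⟨hg, hg'⟩
        refine ⟨inv_mem hg, hg'.mono fun z hz => ?_⟩
        change g.symm z = z
        rw [g.symm_apply_eq, hz] }
  have hΓ : LocallyTransitiveOn Γ (V \ {r}) := by
    rintro x ⟨hxV, hxr⟩ W hW
    obtain ⟨A, B, hA, hB, hxA, hrB, hAB⟩ := t2_separation (show x ≠ r from hxr)
    obtain ⟨O, hO, hxO, h⟩ := locallyTransitiveOn_isotopyGroup x (hV hxV) (W ∩ A)
      (Filter.inter_mem hW (hA.mem_nhds hxA))
    refine ⟨O, hO, hxO, fun y hy y' hy' => ?_⟩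
    obtain ⟨g, hg, hgy, hgW⟩ := h y hy y' hy'
    refine ⟨g, ⟨hg, ?_⟩, hgy, fun z hz => hgW z fun h => hz h.1⟩
    filter_upwards [hB.mem_nhds hrB] with z hz
    exact hgW z fun h => disjoint_left.1 hAB h.2 hz
  obtain ⟨g, hg, hgF⟩ := hΓ.exists_engulf hVr hU hUV hF hFV
  exact ⟨g, hg.1, hg.2, hgF⟩

theorem exists_pingPong [LocallyCompactSpace M] {V : Set M}
    (hV : V ⊆ interiorPts I M) (hVinf : V.Infinite) (hVc : ∀ p ∈ V, IsPreconnected (V \ {p}))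
    (n : ℕ) : ∃ (f : Fin n → (M ≃ₜ M)) (X : Option (Fin n × Bool) → Set M) (q : M),
      (∀ i, f i ∈ isotopyGroup I M) ∧ (∀ j, IsCompact (X j)) ∧ q ∈ X none ∧
      (∀ a, q ∉ X (some a)) ∧ ∀ i, IsPingPong X i (f i) := by
  let p : Option (Fin n × Bool) → M := fun j => hVinf.natEmbedding V (Encodable.encode j)
  have hp : Function.Injective p := Subtype.val_injective.comp
    ((hVinf.natEmbedding V).injective.comp Encodable.encode_injective)
  have hpV : ∀ j, p j ∈ V := fun j => (hVinf.natEmbedding V (Encodable.encode j)).2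
  let rep : Fin n × Bool → Option (Fin n × Bool) := fun a => some (a.1, !a.2)
  have hrep : ∀ a, some a ≠ rep a := by
    rintro ⟨i, b⟩
    cases b <;> simp [rep]
  obtain ⟨U, hU, hUd⟩ := (finite_range p).t2_separation
  let W : Option (Fin n × Bool) → Set M := fun j => U (p j)
  have hW : ∀ j, W j ∈ 𝓝 (p j) := fun j => (hU (p j)).2.mem_nhds (hU (p j)).1
  have hWd : ∀ j k, j ≠ k → Disjoint (W j) (W k) := fun j k hjk =>
    hUd (mem_range_self j) (mem_range_self k) (hp.ne hjk)
  choose Y hY hYW hYs using fun j => exists_shrinkable_nhds (hV (hpV j)) (hW j)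
  have hs : ∀ a, ∃ g ∈ isotopyGroup I M, (∀ᶠ z in 𝓝 (p (rep a)), g z = z) ∧
      ∀ x ∈ p '' {j | j ≠ rep a}, g x ∈ interior (Y (some a)) := by
    intro a
    refine exists_engulf_away_from hV (hVc _ (hpV _)) isOpen_interior
      ⟨p (some a), mem_interior_iff_mem_nhds.2 (hY _), hpV _, hp.ne (hrep a)⟩
      (Set.toFinite _) ?_
    rintro _ ⟨j, hj, rfl⟩
    exact ⟨hpV j, hp.ne hj⟩
  choose s hsI hsid hsU using hs
  have hX : ∀ j, ∃ X ∈ 𝓝 (p j), X ⊆ {z | z ∈ W j ∧ ∀ a, (j = rep a → s a z = z) ∧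
      (j ≠ rep a → s a z ∈ interior (Y (some a)))} ∧ IsCompact X := by
    intro j
    apply local_compact_nhds
    refine Filter.Eventually.and (hW j) (Filter.eventually_all.2 fun a => ?_)
    by_cases h : j = rep a
    · subst h
      simpa using hsid a
    · have h1 : s a (p j) ∈ interior (Y (some a)) := hsU a _ ⟨j, h, rfl⟩
      have h2 : ∀ᶠ z in 𝓝 (p j), s a z ∈ interior (Y (some a)) :=
        (s a).continuous.continuousAt (isOpen_interior.mem_nhds h1)
      exact h2.mono fun z hz => ⟨fun h' => absurd h' h, fun _ => hz⟩
  choose X hX hXs hXc using hX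
  choose c hcI hcY hcW using fun a : Fin n × Bool =>
    hYs (some a) (interior (X (some a))) (interior_mem_nhds.2 (hX _))
  let σ : Fin n × Bool → (M ≃ₜ M) := fun a => c a * s a
  have hσ : ∀ a j, j ≠ rep a → MapsTo (σ a) (X j) (interior (X (some a))) := fun a j hj z hz =>
    hcY a (interior_subset (((hXs j hz).2 a).2 hj))
  have hσid : ∀ a, ∀ z ∈ X (rep a), σ a z = z := by
    intro a z hz
    change c a (s a z) = z
    rw [((hXs _ hz).2 a).1 rfl]
    exact hcW a z fun h => disjoint_left.1 (hWd _ _ (hrep a)) h (hXs _ hz).1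
  have hσI : ∀ a, σ a ∈ isotopyGroup I M := fun a => mul_mem (hcI a) (hsI a)
  refine ⟨fun i => (σ (i, false))⁻¹ * σ (i, true), X, p none,
    fun i => mul_mem (inv_mem (hσI _)) (hσI _), hXc, mem_of_mem_nhds (hX none),
    fun a h => disjoint_left.1 (hWd none (some a) (by simp)) (hU (p none)).1 (hXs _ h).1,
    fun i j => ⟨fun hj z hz => ?_, fun hj z hz hz' => ?_⟩⟩
  · have h1 := hσ (i, true) j hj hz
    have h2 := hσid (i, false) _ (interior_subset h1)
    have h3 : (σ (i, false)).symm (σ (i, true) z) = σ (i, true) z := by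
      rw [(σ (i, false)).symm_apply_eq, h2]
    change (σ (i, false)).symm (σ (i, true) z) ∈ _
    rwa [h3]
  · change (σ (i, false)).symm (σ (i, true) z) ∈ X j at hz'
    have h1 := hσ (i, false) j hj hz'
    rw [Homeomorph.apply_symm_apply] at h1
    have h2 := hσid (i, true) _ (interior_subset h1)
    rw [(σ (i, true)).injective h2] at h1
    exact hz h1

end Table

end

noncomputable section

/-! ### Dimension at least two -/

section HigherDim

variable {E : Type*} [NormedAddCommGroup E] [NormedSpace ℝ E]

theorem isPreconnected_ball_diff_singleton (h : 1 < Module.rank ℝ E) (c w : E) {R : ℝ}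
    (hR : 0 < R) : IsPreconnected (Metric.ball c R \ {w}) := by
  let u := OpenPartialHomeomorph.univBall c R
  have hs : u.source = univ := OpenPartialHomeomorph.univBall_source c R
  have ht : u.target = Metric.ball c R := OpenPartialHomeomorph.univBall_target c hR
  by_cases hw : w ∈ Metric.ball c R
  · have : Metric.ball c R \ {w} = u '' {u.symm w}ᶜ := by
      rw [← ht] at hw ⊢
      ext z
      constructor
      · rintro ⟨hz, hzw⟩
        exact ⟨u.symm z, fun h => hzw (u.symm.injOn hz hw h), u.right_inv hz⟩
      · rintro ⟨y, hy, rfl⟩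
        refine ⟨u.map_source (hs ▸ mem_univ y), fun h => hy ?_⟩
        rw [mem_singleton_iff, ← mem_singleton_iff.1 h, u.left_inv (hs ▸ mem_univ y)]
    rw [this]
    exact (isConnected_compl_singleton_of_one_lt_rank h _).isPreconnected.image _
      (u.continuousOn.mono (hs ▸ subset_univ _))
  · rw [sdiff_singleton_eq_self hw]
    exact (convex_ball c R).isPreconnected

variable {H : Type*} [TopologicalSpace H] {I : ModelWithCorners ℝ E H}
  {M : Type*} [TopologicalSpace M]

theorem exists_mem_interior_extend_target (e : OpenPartialHomeomorph M H) {x : M}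
    (hx : x ∈ e.source) : (interior (e.extend I).target).Nonempty := by
  have hA : IsOpen (I.symm ⁻¹' e.target) := e.open_target.preimage I.continuous_symm
  have h1 : e.extend I x ∈ (e.extend I).target :=
    (e.extend I).map_source (by rwa [e.extend_source])
  rw [e.extend_target] at h1 ⊢
  obtain ⟨z, hzA, hz⟩ := mem_closure_iff.1 (I.range_subset_closure_interior h1.2) _ hA h1.1
  refine ⟨z, ?_⟩
  rw [interior_inter, hA.interior_eq]
  exact ⟨hzA, hz⟩

variable [ChartedSpace H M]

theorem exists_open_nonseparated [Nonempty M] (h : 1 < Module.rank ℝ E) :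
    ∃ V : Set M, V ⊆ interiorPts I M ∧ V.Infinite ∧
      ∀ p ∈ V, IsPreconnected (V \ {p}) := by
  obtain ⟨x⟩ := ‹Nonempty M›
  set e := chartAt H x
  obtain ⟨c, hc⟩ := exists_mem_interior_extend_target (I := I) e (mem_chart_source H x)
  obtain ⟨R, hR, hball⟩ := Metric.isOpen_iff.1 isOpen_interior c hc
  have hbt : Metric.ball c R ⊆ (e.extend I).target := hball.trans interior_subset
  have hV : (e.extend I).source ∩ e.extend I ⁻¹' Metric.ball c R =
      (e.extend I).symm '' Metric.ball c R := by
    rw [(e.extend I).symm_image_eq_source_inter_preimage hbt]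
  have hinj : InjOn (e.extend I).symm (Metric.ball c R) :=
    (e.extend I).symm.injOn.mono hbt
  refine ⟨(e.extend I).symm '' Metric.ball c R, ?_, ?_, ?_⟩
  · rw [← hV, e.extend_source]
    exact fun y hy => ⟨e, chart_mem_atlas H x, hy.1, hball hy.2⟩
  · refine Set.Infinite.image hinj ?_
    have : Nontrivial E := by
      by_contra hn
      rw [not_nontrivial_iff_subsingleton] at hn
      simp at h
    exact infinite_of_mem_nhds c (Metric.ball_mem_nhds c hR)
  · rintro _ ⟨w, hw, rfl⟩
    have h1 : (e.extend I).symm '' Metric.ball c R \ {(e.extend I).symm w} =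
        (e.extend I).symm '' (Metric.ball c R \ {w}) := by
      rw [hinj.image_sdiff_subset (singleton_subset_iff.2 hw), image_singleton]
    rw [h1]
    exact (isPreconnected_ball_diff_singleton h c w hR).image _
      (e.continuousOn_extend_symm.mono (sdiff_subset.trans hbt))

end HigherDim

end

noncomputable section

/-! ### Arcs in one-dimensional manifolds -/

section Arcs

variable {M : Type*} [TopologicalSpace M]

/-- `γ` is an open embedding of the set `J` of real numbers, with inverse `u`. -/
structure IsArc (γ : ℝ → M) (u : M → ℝ) (J : Set ℝ) : Prop where
  continuousOn : ContinuousOn γ J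
  isOpen_image : IsOpen (γ '' J)
  continuousOn_inv : ContinuousOn u (γ '' J)
  left_inv : ∀ t ∈ J, u (γ t) = t

namespace IsArc

variable {γ ψ : ℝ → M} {u : M → ℝ} {J : Set ℝ}

theorem injOn (h : IsArc γ u J) : InjOn γ J := fun s hs t ht hst => by
  rw [← h.left_inv s hs, ← h.left_inv t ht, hst]

theorem inv_mem (h : IsArc γ u J) {x : M} (hx : x ∈ γ '' J) : u x ∈ J := by
  obtain ⟨t, ht, rfl⟩ := hx
  rwa [h.left_inv t ht]

theorem right_inv (h : IsArc γ u J) {x : M} (hx : x ∈ γ '' J) : γ (u x) = x := by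
  obtain ⟨t, ht, rfl⟩ := hx
  rw [h.left_inv t ht]

theorem isOpen_image_inter (h : IsArc γ u J) {s : Set ℝ} (hs : IsOpen s) :
    IsOpen (γ '' (J ∩ s)) := by
  have : γ '' (J ∩ s) = γ '' J ∩ u ⁻¹' s := by
    ext x
    constructor
    · rintro ⟨t, ht, rfl⟩
      exact ⟨⟨t, ht.1, rfl⟩, by rw [mem_preimage, h.left_inv t ht.1]; exact ht.2⟩
    · rintro ⟨hx, hxs⟩
      exact ⟨u x, ⟨h.inv_mem hx, hxs⟩, h.right_inv hx⟩
  rw [this]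
  exact h.continuousOn_inv.isOpen_inter_preimage h.isOpen_image hs

theorem comp_homeomorph (h : IsArc γ u J) (g : M ≃ₜ M) : IsArc (g ∘ γ) (u ∘ g.symm) J where
  continuousOn := g.continuous.comp_continuousOn h.continuousOn
  isOpen_image := by
    rw [image_comp]
    exact g.isOpenMap _ h.isOpen_image
  continuousOn_inv := by
    refine h.continuousOn_inv.comp g.symm.continuous.continuousOn ?_
    rintro _ ⟨t, ht, rfl⟩
    exact ⟨t, ht, by simp⟩
  left_inv t ht := by simp [h.left_inv t ht]

/-- A path that stays in an arc except at an end point is not confined to a compact part of the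
arc. -/
theorem exists_notMem_Icc [T2Space M] (h : IsArc γ u J) {S : Set ℝ} {a : ℝ} (ha : a ∈ closure S)
    (hψ : ContinuousWithinAt ψ S a) (hS : MapsTo ψ S (γ '' J)) (hψa : ψ a ∉ γ '' J) {y z : ℝ}
    (hyz : Icc y z ⊆ J) : ∃ t ∈ S, u (ψ t) ∉ Icc y z := by
  by_contra! hall
  have hcl : IsClosed (γ '' Icc y z) :=
    (isCompact_Icc.image_of_continuousOn (h.continuousOn.mono hyz)).isClosed
  have hmaps : MapsTo ψ S (γ '' Icc y z) := fun t ht => ⟨_, hall t ht, h.right_inv (hS ht)⟩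
  have := hψ.mem_closure ha hmaps
  rw [hcl.closure_eq] at this
  exact hψa (image_mono hyz this)

variable {R : ℝ} {S : Set ℝ} {a c : ℝ}

theorem exists_eq_of_mem_image (h : IsArc γ u J) (hS : MapsTo ψ S (γ '' J)) {y : ℝ}
    (hy : y ∈ u ∘ ψ '' S) : ∃ t ∈ S, ψ t = γ y := by
  obtain ⟨t, ht, rfl⟩ := hy
  exact ⟨t, ht, (h.right_inv (hS ht)).symm⟩

theorem ordConnected_image (h : IsArc γ u J) (hSc : IsPreconnected S) (hψS : ContinuousOn ψ S)
    (hS : MapsTo ψ S (γ '' J)) : OrdConnected (u ∘ ψ '' S) :=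
  (hSc.image _ (h.continuousOn_inv.comp hψS hS)).ordConnected

theorem covers_end_Ico [T2Space M] (h : IsArc γ u (Ico 0 R)) (hSc : IsPreconnected S)
    (ha : a ∈ closure S) (hψS : ContinuousOn ψ S) (hψ : ContinuousWithinAt ψ S a)
    (hS : MapsTo ψ S (γ '' Ico 0 R)) (hψa : ψ a ∉ γ '' Ico 0 R) (hc : c ∈ S) {y : ℝ}
    (hy : y < R) (hcy : u (ψ c) ≤ y) : ∃ t ∈ S, ψ t = γ y := by
  apply h.exists_eq_of_mem_image hS
  obtain ⟨t, ht, htn⟩ := h.exists_notMem_Icc ha hψ hS hψa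
    (y := 0) (z := y) fun z hz => ⟨hz.1, hz.2.trans_lt hy⟩
  have hty : y ≤ u (ψ t) := by
    by_contra! hlt
    exact htn ⟨(h.inv_mem (hS ht)).1, hlt.le⟩
  exact (h.ordConnected_image hSc hψS hS).out ⟨c, hc, rfl⟩ ⟨t, ht, rfl⟩ ⟨hcy, hty⟩

theorem covers_end_Ioo [T2Space M] (h : IsArc γ u (Ioo (-R) R)) (hSc : IsPreconnected S)
    (ha : a ∈ closure S) (hψS : ContinuousOn ψ S) (hψ : ContinuousWithinAt ψ S a)
    (hS : MapsTo ψ S (γ '' Ioo (-R) R)) (hψa : ψ a ∉ γ '' Ioo (-R) R) (hc : c ∈ S) :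
    (∀ y < R, u (ψ c) ≤ y → ∃ t ∈ S, ψ t = γ y) ∨
    (∀ y > -R, y ≤ u (ψ c) → ∃ t ∈ S, ψ t = γ y) := by
  by_contra! hcon
  obtain ⟨⟨y, hyR, hcy, hy⟩, ⟨z, hzR, hzc, hz⟩⟩ := hcon
  have hoc := h.ordConnected_image hSc hψS hS
  have hy' : y ∉ u ∘ ψ '' S := fun h' => by
    obtain ⟨t, ht, hty⟩ := h.exists_eq_of_mem_image hS h'
    exact hy t ht hty
  have hz' : z ∉ u ∘ ψ '' S := fun h' => by
    obtain ⟨t, ht, hty⟩ := h.exists_eq_of_mem_image hS h'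
    exact hz t ht hty
  obtain ⟨t, ht, htn⟩ := h.exists_notMem_Icc ha hψ hS hψa
    (y := z) (z := y) fun w hw => ⟨hzR.trans_le hw.1, hw.2.trans_lt hyR⟩
  rcases lt_or_ge (u (ψ t)) z with h1 | h1
  · exact hz' (hoc.out ⟨t, ht, rfl⟩ ⟨c, hc, rfl⟩ ⟨h1.le, hzc⟩)
  rcases lt_or_ge y (u (ψ t)) with h2 | h2
  · exact hy' (hoc.out ⟨c, hc, rfl⟩ ⟨t, ht, rfl⟩ ⟨hcy, h2.le⟩)
  · exact htn ⟨h1, h2⟩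

end IsArc

/-- The parameters at which a path is outside an open set form a compact set. -/
theorem isCompact_setOf_notMem {ψ : ℝ → M} {A B : ℝ} (hψ : ContinuousOn ψ (Icc A B)) {O : Set M}
    (hO : IsOpen O) : IsCompact (Icc A B ∩ ψ ⁻¹' Oᶜ) :=
  isCompact_Icc.of_isClosed_subset
    (hψ.preimage_isClosed_of_isClosed isClosed_Icc hO.isClosed_compl) inter_subset_left

variable {γ ψ : ℝ → M} {u w : M → ℝ} {R A B : ℝ}

/-- The first and the last parameter at which a path is outside an open set. -/
theorem exists_first_last {A B : ℝ} (hψ : ContinuousOn ψ (Icc A B)) {O : Set M}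
    (hO : IsOpen O) (hA : ψ A ∈ O) (hB : ψ B ∈ O) (hne : ¬ MapsTo ψ (Icc A B) O) :
    ∃ a b, A < a ∧ a ≤ b ∧ b < B ∧ ψ a ∉ O ∧ ψ b ∉ O ∧ MapsTo ψ (Ico A a) O ∧
      MapsTo ψ (Ioc b B) O := by
  have hC := isCompact_setOf_notMem hψ hO
  have hCne : (Icc A B ∩ ψ ⁻¹' Oᶜ).Nonempty := by
    simp only [MapsTo, not_forall] at hne
    obtain ⟨t, ht, htO⟩ := hne
    exact ⟨t, ht, htO⟩
  obtain ⟨a, ⟨haI, haO⟩, ha⟩ := hC.exists_isLeast hCne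
  obtain ⟨b, ⟨hbI, hbO⟩, hb⟩ := hC.exists_isGreatest hCne
  refine ⟨a, b, lt_of_le_of_ne haI.1 ?_, ha ⟨hbI, hbO⟩, lt_of_le_of_ne hbI.2 ?_, haO, hbO,
    fun t ht => ?_, fun t ht => ?_⟩
  · rintro rfl
    exact haO hA
  · rintro rfl
    exact hbO hB
  · by_contra htO
    exact (ha ⟨⟨ht.1, ht.2.le.trans haI.2⟩, htO⟩).not_gt ht.2
  · by_contra htO
    exact (hb ⟨⟨hbI.1.trans ht.1.le, ht.2⟩, htO⟩).not_gt ht.1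

theorem left_mem_closure_Ioc {a b : ℝ} (h : a < b) : a ∈ closure (Ioc a b) := by
  rw [closure_Ioc h.ne]
  exact left_mem_Icc.2 h.le

theorem right_mem_closure_Ico {a b : ℝ} (h : a < b) : b ∈ closure (Ico a b) := by
  rw [closure_Ico h.ne]
  exact right_mem_Icc.2 h.le

/-- A path between two points of a half-open arc does not leave the arc. -/
theorem IsArc.mapsTo_of_Ico [T2Space M] (h : IsArc γ u (Ico 0 R)) (hψ : ContinuousOn ψ (Icc A B))
    (hinj : InjOn ψ (Icc A B)) (hA : ψ A ∈ γ '' Ico 0 R) (hB : ψ B ∈ γ '' Ico 0 R) :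
    MapsTo ψ (Icc A B) (γ '' Ico 0 R) := by
  by_contra hne
  obtain ⟨a, b, hAa, hab, hbB, ha, hb, hSa, hSb⟩ :=
    exists_first_last hψ h.isOpen_image hA hB hne
  have hsa : Icc A a ⊆ Icc A B := Icc_subset_Icc_right (hab.trans hbB.le)
  have hsb : Icc b B ⊆ Icc A B := Icc_subset_Icc_left (hAa.le.trans hab)
  have hy : max (u (ψ A)) (u (ψ B)) < R := max_lt (h.inv_mem hA).2 (h.inv_mem hB).2
  obtain ⟨s, hs, hs'⟩ := h.covers_end_Ico isPreconnected_Ico (right_mem_closure_Ico hAa)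
    (hψ.mono (Ico_subset_Icc_self.trans hsa))
    ((hψ a (hsa (right_mem_Icc.2 hAa.le))).mono (Ico_subset_Icc_self.trans hsa)) hSa ha
    (left_mem_Ico.2 hAa) hy (le_max_left _ _)
  obtain ⟨t, ht, ht'⟩ := h.covers_end_Ico isPreconnected_Ioc (left_mem_closure_Ioc hbB)
    (hψ.mono (Ioc_subset_Icc_self.trans hsb))
    ((hψ b (hsb (left_mem_Icc.2 hbB.le))).mono (Ioc_subset_Icc_self.trans hsb)) hSb hb
    (right_mem_Ioc.2 hbB) hy (le_max_right _ _)
  have := hinj (hsa (Ico_subset_Icc_self hs)) (hsb (Ioc_subset_Icc_self ht)) (hs'.trans ht'.symm)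
  linarith [hs.2, ht.1]

/-- If an arc leaves an open arc between two of its points, then the space is a circle. -/
theorem IsArc.exists_isPreconnected_compl [T2Space M] [PreconnectedSpace M] {J : Set ℝ}
    (h : IsArc γ u (Ioo (-R) R)) (hψ : IsArc ψ w J) (hJ : Icc A B ⊆ J) (hA : ψ A ∈ γ '' Ioo (-R) R)
    (hB : ψ B ∈ γ '' Ioo (-R) R) (hne : ¬ MapsTo ψ (Icc A B) (γ '' Ioo (-R) R)) :
    ∃ p : M, IsPreconnected ({p}ᶜ : Set M) := by
  have hψc : ContinuousOn ψ (Icc A B) := hψ.continuousOn.mono hJ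
  have hinj : InjOn ψ (Icc A B) := hψ.injOn.mono hJ
  obtain ⟨a, b, hAa, hab, hbB, ha, hb, hSa, hSb⟩ :=
    exists_first_last hψc h.isOpen_image hA hB hne
  have hsa : Icc A a ⊆ Icc A B := Icc_subset_Icc_right (hab.trans hbB.le)
  have hsb : Icc b B ⊆ Icc A B := Icc_subset_Icc_left (hAa.le.trans hab)
  have hends : ∀ y, ∀ s ∈ Ico A a, ∀ t ∈ Ioc b B, ψ s = γ y → ψ t ≠ γ y := by
    intro y s hs t ht hs' ht'
    have := hinj (hsa (Ico_subset_Icc_self hs)) (hsb (Ioc_subset_Icc_self ht))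
      (hs'.trans ht'.symm)
    linarith [hs.2, ht.1]
  have hsub : uIcc (u (ψ A)) (u (ψ B)) ⊆ Ioo (-R) R :=
    ordConnected_Ioo.uIcc_subset (h.inv_mem hA) (h.inv_mem hB)
  have hmax : max (u (ψ A)) (u (ψ B)) < R := max_lt (h.inv_mem hA).2 (h.inv_mem hB).2
  have hmin : -R < min (u (ψ A)) (u (ψ B)) := lt_min (h.inv_mem hA).1 (h.inv_mem hB).1
  have hcov : γ '' Ioo (-R) R ⊆ ψ '' Icc A B ∪ γ '' uIcc (u (ψ A)) (u (ψ B)) := by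
    rintro _ ⟨y, hy, rfl⟩
    by_cases hyu : y ∈ uIcc (u (ψ A)) (u (ψ B))
    · exact Or.inr ⟨y, hyu, rfl⟩
    left
    have key : (∃ t ∈ Ico A a, ψ t = γ y) ∨ ∃ t ∈ Ioc b B, ψ t = γ y := by
      rcases h.covers_end_Ioo isPreconnected_Ico (right_mem_closure_Ico hAa)
        (hψc.mono (Ico_subset_Icc_self.trans hsa))
        ((hψc a (hsa (right_mem_Icc.2 hAa.le))).mono (Ico_subset_Icc_self.trans hsa)) hSa ha
        (left_mem_Ico.2 hAa) with h1 | h1 <;>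
      rcases h.covers_end_Ioo isPreconnected_Ioc (left_mem_closure_Ioc hbB)
        (hψc.mono (Ioc_subset_Icc_self.trans hsb))
        ((hψc b (hsb (left_mem_Icc.2 hbB.le))).mono (Ioc_subset_Icc_self.trans hsb)) hSb hb
        (right_mem_Ioc.2 hbB) with h2 | h2
      · obtain ⟨s, hs, hs'⟩ := h1 _ hmax (le_max_left _ _)
        obtain ⟨t, ht, ht'⟩ := h2 _ hmax (le_max_right _ _)
        exact absurd ht' (hends _ s hs t ht hs')
      · rcases le_total (u (ψ A)) y with h3 | h3
        · exact Or.inl (h1 y hy.2 h3)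
        rcases le_total y (u (ψ B)) with h4 | h4
        · exact Or.inr (h2 y hy.1 h4)
        · exact absurd (mem_uIcc.2 (Or.inr ⟨h4, h3⟩)) hyu
      · rcases le_total y (u (ψ A)) with h3 | h3
        · exact Or.inl (h1 y hy.1 h3)
        rcases le_total (u (ψ B)) y with h4 | h4
        · exact Or.inr (h2 y hy.2 h4)
        · exact absurd (mem_uIcc.2 (Or.inl ⟨h3, h4⟩)) hyu
      · obtain ⟨s, hs, hs'⟩ := h1 _ hmin (min_le_left _ _)
        obtain ⟨t, ht, ht'⟩ := h2 _ hmin (min_le_right _ _)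
        exact absurd ht' (hends _ s hs t ht hs')
    rcases key with ⟨t, ht, hty⟩ | ⟨t, ht, hty⟩
    · exact ⟨t, hsa (Ico_subset_Icc_self ht), hty⟩
    · exact ⟨t, hsb (Ioc_subset_Icc_self ht), hty⟩
  have heq : ψ '' Icc A B ∪ γ '' uIcc (u (ψ A)) (u (ψ B)) =
      ψ '' (J ∩ Ioo A B) ∪ γ '' Ioo (-R) R := by
    refine Subset.antisymm (union_subset ?_ ?_) (union_subset ?_ hcov)
    · rintro _ ⟨t, ht, rfl⟩
      rcases ht.1.eq_or_lt with rfl | h1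
      · exact Or.inr hA
      rcases ht.2.eq_or_lt with rfl | h2
      · exact Or.inr hB
      · exact Or.inl ⟨t, ⟨hJ ht, h1, h2⟩, rfl⟩
    · exact (image_mono hsub).trans subset_union_right
    · exact (image_mono (inter_subset_right.trans Ioo_subset_Icc_self)).trans subset_union_left
  have hclopen : IsClopen (ψ '' Icc A B ∪ γ '' uIcc (u (ψ A)) (u (ψ B))) := by
    constructor
    · exact ((isCompact_Icc.image_of_continuousOn hψc).union
        (isCompact_uIcc.image_of_continuousOn (h.continuousOn.mono hsub))).isClosed
    · rw [heq]
      exact (hψ.isOpen_image_inter isOpen_Ioo).union h.isOpen_image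
  have hAB : A ≤ B := hAa.le.trans (hab.trans hbB.le)
  have huniv := hclopen.eq_univ ⟨ψ A, Or.inl ⟨A, left_mem_Icc.2 hAB, rfl⟩⟩
  have hsb' : Icc a B ⊆ Icc A B := Icc_subset_Icc_left hAa.le
  refine ⟨ψ a, ?_⟩
  have hcompl : ({ψ a}ᶜ : Set M) =
      (ψ '' Ico A a ∪ γ '' Ioo (-R) R) ∪ ψ '' Ioc a B := by
    refine Subset.antisymm (fun x hx => ?_) (union_subset (union_subset ?_ ?_) ?_)
    · have hxu : x ∈ ψ '' Icc A B ∪ γ '' uIcc (u (ψ A)) (u (ψ B)) := huniv ▸ mem_univ x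
      rcases hxu with ⟨t, ht, rfl⟩ | hx'
      · rcases lt_trichotomy t a with h1 | rfl | h1
        · exact Or.inl (Or.inl ⟨t, ⟨ht.1, h1⟩, rfl⟩)
        · exact absurd rfl hx
        · exact Or.inr ⟨t, ⟨h1, ht.2⟩, rfl⟩
      · exact Or.inl (Or.inr (image_mono hsub hx'))
    · rintro _ ⟨t, ht, rfl⟩ hta
      have := hinj (hsa (Ico_subset_Icc_self ht)) (hsa (right_mem_Icc.2 hAa.le)) hta
      linarith [ht.2]
    · rintro x hx rfl
      exact ha hx
    · rintro _ ⟨t, ht, rfl⟩ hta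
      have := hinj (hsb' (Ioc_subset_Icc_self ht)) (hsa (right_mem_Icc.2 hAa.le)) hta
      linarith [ht.1]
  rw [hcompl]
  have hγ : IsPreconnected (γ '' Ioo (-R) R) := isPreconnected_Ioo.image _ h.continuousOn
  have h1 : IsPreconnected (ψ '' Ico A a) :=
    isPreconnected_Ico.image _ (hψc.mono (Ico_subset_Icc_self.trans hsa))
  have h2 : IsPreconnected (ψ '' Ioc a B) :=
    isPreconnected_Ioc.image _ (hψc.mono (Ioc_subset_Icc_self.trans hsb'))
  refine IsPreconnected.union (ψ B) (Or.inr hB) ⟨B, right_mem_Ioc.2 (hab.trans_lt hbB), rfl⟩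
    (IsPreconnected.union (ψ A) ⟨A, left_mem_Ico.2 hAa, rfl⟩ hA h1 hγ) h2

/-- Two half-open arcs, starting at different boundary points, and meeting: the space is a closed
interval. -/
theorem IsArc.nonempty_homeomorph_Icc [T2Space M] [PreconnectedSpace M] {R' : ℝ}
    (h : IsArc γ u (Ico 0 R)) (hψ : IsArc ψ w (Ico 0 R')) (hBpos : 0 < B) (hBR : B < R')
    (h0 : ψ 0 ∉ γ '' Ico 0 R) (hB : ψ B ∈ γ '' Ico 0 R) :
    Nonempty (M ≃ₜ Icc (0 : ℝ) 1) := by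
  have hJ : Icc 0 B ⊆ Ico 0 R' := fun t ht => ⟨ht.1, ht.2.trans_lt hBR⟩
  have hψc : ContinuousOn ψ (Icc 0 B) := hψ.continuousOn.mono hJ
  have hinj : InjOn ψ (Icc 0 B) := hψ.injOn.mono hJ
  set s := u (ψ B) with hs
  have hsJ : s ∈ Ico 0 R := h.inv_mem hB
  have hγs : γ s = ψ B := h.right_inv hB
  have hsub : Icc 0 s ⊆ Ico 0 R := fun t ht => ⟨ht.1, ht.2.trans_lt hsJ.2⟩
  have hend : ∀ t ∈ Icc 0 B, ψ t ∈ γ '' Ico 0 R → ∀ y < R, u (ψ t) ≤ y →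
      ∃ t' ∈ Icc 0 t, ψ t' = γ y := by
    intro t ht htO y hy hty
    have hst : Icc 0 t ⊆ Icc 0 B := Icc_subset_Icc_right ht.2
    obtain ⟨a, ⟨haI, haO⟩, ha⟩ := (isCompact_setOf_notMem (hψc.mono hst)
      h.isOpen_image).exists_isGreatest ⟨0, left_mem_Icc.2 ht.1, h0⟩
    have hat : a < t := lt_of_le_of_ne haI.2 (by rintro rfl; exact haO htO)
    have hsub' : Ioc a t ⊆ Icc 0 t := fun z hz => ⟨haI.1.trans hz.1.le, hz.2⟩
    obtain ⟨t', ht', hty'⟩ := h.covers_end_Ico isPreconnected_Ioc (left_mem_closure_Ioc hat)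
      (hψc.mono (hsub'.trans hst)) ((hψc a (hst haI)).mono (hsub'.trans hst))
      (fun z hz => by
        by_contra hzO
        exact (ha ⟨hsub' hz, hzO⟩).not_gt hz.1) haO (right_mem_Ioc.2 hat) hy hty
    exact ⟨t', hsub' ht', hty'⟩
  have hBI : B ∈ Icc 0 B := right_mem_Icc.2 hBpos.le
  have heq : γ '' Icc 0 s ∪ ψ '' Icc 0 B = γ '' Ico 0 R ∪ ψ '' (Ico 0 R' ∩ Iio B) := by
    refine Subset.antisymm (union_subset ((image_mono hsub).trans subset_union_left) ?_)
      (union_subset ?_ ?_)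
    · rintro _ ⟨t, ht, rfl⟩
      rcases ht.2.eq_or_lt with rfl | h1
      · exact Or.inl hB
      · exact Or.inr ⟨t, ⟨hJ ht, h1⟩, rfl⟩
    · rintro _ ⟨y, hy, rfl⟩
      rcases le_total y s with h1 | h1
      · exact Or.inl ⟨y, ⟨hy.1, h1⟩, rfl⟩
      · obtain ⟨t, ht, hty⟩ := hend B hBI hB y hy.2 h1
        exact Or.inr ⟨t, ht, hty⟩
    · rintro _ ⟨t, ht, rfl⟩
      exact Or.inr ⟨t, ⟨ht.1.1, le_of_lt ht.2⟩, rfl⟩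
  have hclopen : IsClopen (γ '' Icc 0 s ∪ ψ '' Icc 0 B) := by
    constructor
    · exact ((isCompact_Icc.image_of_continuousOn (h.continuousOn.mono hsub)).union
        (isCompact_Icc.image_of_continuousOn hψc)).isClosed
    · rw [heq]
      exact h.isOpen_image.union (hψ.isOpen_image_inter isOpen_Iio)
  have huniv := hclopen.eq_univ ⟨ψ B, Or.inr ⟨B, hBI, rfl⟩⟩
  have hdisj : ∀ y ∈ Ico 0 s, ∀ t ∈ Icc 0 B, γ y ≠ ψ t := by
    intro y hy t ht hyt
    have hyJ : y ∈ Ico 0 R := hsub (Ico_subset_Icc_self hy)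
    have huy : u (ψ t) = y := by rw [← hyt, h.left_inv y hyJ]
    obtain ⟨t', ht', hts⟩ := hend t ht (hyt ▸ ⟨y, hyJ, rfl⟩) s hsJ.2 (huy ▸ hy.2.le)
    have h1 := hinj ⟨ht'.1, ht'.2.trans ht.2⟩ hBI (hts.trans hγs)
    have h2 : t = B := le_antisymm ht.2 (h1 ▸ ht'.2)
    rw [h2, ← hs] at huy
    exact hy.2.ne huy.symm
  let k : ℝ → M := fun t => if t ≤ s then γ t else ψ (s + B - t)
  have hk1 : ∀ t ≤ s, k t = γ t := fun t ht => if_pos ht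
  have hk2 : ∀ t, s ≤ t → k t = ψ (s + B - t) := by
    intro t ht
    rcases ht.eq_or_lt with rfl | ht
    · rw [hk1 _ le_rfl, hγs, add_sub_cancel_left]
    · exact if_neg ht.not_ge
  have hkc : ContinuousOn k (Icc 0 (s + B)) := by
    rw [← Icc_union_Icc_eq_Icc hsJ.1 (by linarith : s ≤ s + B)]
    refine ContinuousOn.union_of_isClosed ?_ ?_ isClosed_Icc isClosed_Icc
    · exact (h.continuousOn.mono hsub).congr fun t ht => hk1 t ht.2
    · refine ContinuousOn.congr (f := fun t => ψ (s + B - t)) ?_ fun t ht => hk2 t ht.1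
      exact hψc.comp (by fun_prop) fun t ht => ⟨by linarith [ht.2], by linarith [ht.1]⟩
  have hkinj : InjOn k (Icc 0 (s + B)) := by
    have hlt : ∀ t ∈ Icc 0 (s + B), ∀ t' ∈ Icc 0 (s + B), t < t' → k t ≠ k t' := by
      intro t ht t' ht' htt hkt
      rcases le_total t' s with h1 | h1
      · rw [hk1 _ h1, hk1 _ (htt.le.trans h1)] at hkt
        exact htt.ne (h.injOn (hsub ⟨ht.1, htt.le.trans h1⟩) (hsub ⟨ht'.1, h1⟩) hkt)
      · have hm' : s + B - t' ∈ Icc 0 B := ⟨by linarith [ht'.2], by linarith⟩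
        rcases lt_or_ge t s with h2 | h2
        · rw [hk1 _ h2.le, hk2 _ h1] at hkt
          exact hdisj t ⟨ht.1, h2⟩ _ hm' hkt
        · rw [hk2 _ h2, hk2 _ h1] at hkt
          have := hinj ⟨by linarith [ht.2], by linarith⟩ hm' hkt
          linarith
    intro t ht t' ht' hkt
    rcases lt_trichotomy t t' with h1 | h1 | h1
    · exact absurd hkt (hlt t ht t' ht' h1)
    · exact h1
    · exact absurd hkt.symm (hlt t' ht' t ht h1)
  have hksurj : ∀ x, ∃ t ∈ Icc 0 (s + B), k t = x := by
    intro x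
    have hx : x ∈ γ '' Icc 0 s ∪ ψ '' Icc 0 B := huniv ▸ mem_univ x
    rcases hx with ⟨t, ht, rfl⟩ | ⟨t, ht, rfl⟩
    · exact ⟨t, ⟨ht.1, ht.2.trans (by linarith)⟩, hk1 t ht.2⟩
    · refine ⟨s + B - t, ⟨by linarith [ht.2, hsJ.1], by linarith [ht.1]⟩, ?_⟩
      rw [hk2 _ (by linarith [ht.2])]
      congr 1
      ring
  let e : Icc 0 (s + B) ≃ M := Equiv.ofBijective (fun t => k t)
    ⟨fun t t' htt => Subtype.ext (hkinj t.2 t'.2 htt), fun x => by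
      obtain ⟨t, ht, rfl⟩ := hksurj x
      exact ⟨⟨t, ht⟩, rfl⟩⟩
  have he : Continuous e := continuousOn_iff_continuous_domRestrict.1 hkc
  exact ⟨he.homeoOfEquivCompactToT2.symm.trans (iccHomeoI 0 (s + B) (by linarith [hsJ.1]))⟩

end Arcs

end

noncomputable section

/-! ### Dimension one -/

section DimOne

theorem not_isCompact_of_isArc {M : Type*} [TopologicalSpace M] {γ : ℝ → M} {u : M → ℝ}
    {J : Set ℝ} (h : IsArc γ u J) {a R : ℝ} (haJ : a ∈ J) (hJR : ∀ t ∈ J, t < R)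
    (hJ : ∀ t, a ≤ t → t < R → t ∈ J) : ¬ IsCompact (γ '' J) := by
  intro hc
  have h1 : IsCompact (u '' (γ '' J)) := hc.image_of_continuousOn h.continuousOn_inv
  have h2 : u '' (γ '' J) = J := by
    rw [image_image]
    exact (image_congr h.left_inv).trans (image_id' J)
  rw [h2] at h1
  obtain ⟨m, hm, hmax⟩ := h1.exists_isGreatest ⟨a, haJ⟩
  have h3 := hJR m hm
  have h4 : (m + R) / 2 ∈ J := hJ _ (by linarith [hmax haJ]) (by linarith)
  linarith [hmax h4]

/-- A dense open subset of a connected space is connected if it does not separate small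
neighbourhoods of any point. -/
theorem isPreconnected_of_locally_nonseparating {M : Type*} [TopologicalSpace M]
    [PreconnectedSpace M] {D : Set M} (hD : IsOpen D) (hDd : Dense D)
    (h : ∀ x, ∃ V ∈ 𝓝 x, IsPreconnected (V ∩ D)) : IsPreconnected D := by
  intro A B hA hB hAB hDA hDB
  by_contra hcon
  have hdis : Disjoint (D ∩ A) (D ∩ B) := by
    rw [disjoint_left]
    exact fun x hx hx' => hcon ⟨x, hx.1, hx.2, hx'.2⟩
  have hsub : ∀ {C : Set M}, IsOpen C → D ∩ C ⊆ interior (Dᶜ ∪ D ∩ C) := fun hC =>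
    interior_maximal subset_union_right (hD.inter hC)
  have hcov : univ ⊆ interior (Dᶜ ∪ D ∩ A) ∪ interior (Dᶜ ∪ D ∩ B) := by
    intro x _
    obtain ⟨V, hV, hVD⟩ := h x
    have hVC : ∀ {C : Set M}, V ∩ D ⊆ D ∩ C → x ∈ interior (Dᶜ ∪ D ∩ C) := fun hVC =>
      mem_interior_iff_mem_nhds.2 (Filter.mem_of_superset hV fun y hy => by
        by_cases hyD : y ∈ D
        · exact Or.inr (hVC ⟨hy, hyD⟩)
        · exact Or.inl hyD)
    rcases hVD.subset_or_subset (hD.inter hA) (hD.inter hB) hdis (fun y hy =>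
      (hAB hy.2).imp (fun h => ⟨hy.2, h⟩) fun h => ⟨hy.2, h⟩) with h1 | h1
    · exact Or.inl (hVC h1)
    · exact Or.inr (hVC h1)
  obtain ⟨x, -, hx⟩ := isPreconnected_univ _ _ isOpen_interior isOpen_interior hcov
    (hDA.mono fun x hx => ⟨mem_univ x, hsub hA hx⟩) (hDB.mono fun x hx => ⟨mem_univ x, hsub hB hx⟩)
  obtain ⟨y, hy, hyD⟩ := hDd.inter_open_nonempty _ (isOpen_interior.inter isOpen_interior) ⟨x, hx⟩
  have hyA := (interior_subset hy.1).resolve_left fun h => h hyD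
  have hyB := (interior_subset hy.2).resolve_left fun h => h hyD
  exact disjoint_left.1 hdis hyA hyB

variable {H : Type*} [TopologicalSpace H]
  {I : ModelWithCorners ℝ (EuclideanSpace ℝ (Fin 1)) H}
  {M : Type*} [TopologicalSpace M]

theorem euclideanSpace_one_eq (z : EuclideanSpace ℝ (Fin 1)) :
    z 0 • EuclideanSpace.single (0 : Fin 1) (1 : ℝ) = z := by
  ext i
  fin_cases i
  simp

theorem isArc_of_chart {e : OpenPartialHomeomorph M H} {c : EuclideanSpace ℝ (Fin 1)} {R : ℝ}
    (hR : Metric.ball c R ∩ range I ⊆ (e.extend I).target) {J : Set ℝ}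
    (hJ : J = {t | t ∈ Ioo (-R) R ∧ c + t • EuclideanSpace.single (0 : Fin 1) (1 : ℝ) ∈ range I}) :
    IsArc (fun t => (e.extend I).symm (c + t • EuclideanSpace.single (0 : Fin 1) (1 : ℝ)))
      (fun x => (e.extend I x - c) 0) J ∧
    (fun t => (e.extend I).symm (c + t • EuclideanSpace.single (0 : Fin 1) (1 : ℝ))) '' J =
      e.source ∩ e.extend I ⁻¹' Metric.ball c R := by
  set e₀ := EuclideanSpace.single (0 : Fin 1) (1 : ℝ) with he₀
  have hnorm : ∀ t : ℝ, ‖t • e₀‖ = |t| := fun t => by simp [he₀, norm_smul]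
  have hball : ∀ t ∈ J, c + t • e₀ ∈ Metric.ball c R := by
    intro t ht
    rw [hJ] at ht
    rw [Metric.mem_ball, dist_eq_norm, add_sub_cancel_left, hnorm, abs_lt]
    exact ht.1
  have htar : ∀ t ∈ J, c + t • e₀ ∈ (e.extend I).target := fun t ht =>
    hR ⟨hball t ht, by rw [hJ] at ht; exact ht.2⟩
  have himage : (fun t => (e.extend I).symm (c + t • e₀)) '' J =
      e.source ∩ e.extend I ⁻¹' Metric.ball c R := by
    ext x
    constructor
    · rintro ⟨t, ht, rfl⟩
      refine ⟨by simpa using (e.extend I).map_target (htar t ht), ?_⟩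
      rw [mem_preimage, (e.extend I).right_inv (htar t ht)]
      exact hball t ht
    · rintro ⟨hx, hxb⟩
      have h1 : c + (e.extend I x - c) 0 • e₀ = e.extend I x := by
        rw [euclideanSpace_one_eq, add_sub_cancel]
      refine ⟨(e.extend I x - c) 0, ?_, ?_⟩
      · rw [hJ]
        refine ⟨abs_lt.1 ?_, ?_⟩
        · rw [← hnorm, euclideanSpace_one_eq, ← dist_eq_norm]
          exact hxb
        · rw [h1]
          exact mem_range_self _
      · simp only [h1]
        exact e.extend_left_inv hx
  refine ⟨⟨?_, ?_, ?_, ?_⟩, himage⟩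
  · refine e.continuousOn_extend_symm.comp (Continuous.continuousOn ?_) htar
    fun_prop
  · rw [himage]
    exact (e.continuousOn_extend.mono e.extend_source.ge).isOpen_inter_preimage
      e.open_source Metric.isOpen_ball
  · rw [himage]
    have h1 : ContinuousOn (e.extend I) (e.source ∩ e.extend I ⁻¹' Metric.ball c R) :=
      e.continuousOn_extend.mono (inter_subset_left.trans e.extend_source.ge)
    have h2 : Continuous fun z : EuclideanSpace ℝ (Fin 1) => (z - c) 0 := by fun_prop
    exact h2.comp_continuousOn h1
  · intro t ht
    simp only [(e.extend I).right_inv (htar t ht), add_sub_cancel_left]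
    simp [he₀]

variable [ChartedSpace H M]

theorem exists_isArc_of_mem_interiorPts {x : M} (hx : x ∈ interiorPts I M) :
    ∃ (γ : ℝ → M) (u : M → ℝ) (R : ℝ), 0 < R ∧ IsArc γ u (Ioo (-R) R) ∧ γ 0 = x ∧
      γ '' Ioo (-R) R ⊆ interiorPts I M := by
  obtain ⟨e, he, hxe, hxi⟩ := hx
  obtain ⟨R, hR, hball⟩ := Metric.isOpen_iff.1 isOpen_interior _ hxi
  have hbt := hball.trans interior_subset
  obtain ⟨h1, h2⟩ := isArc_of_chart (I := I) (e := e) (c := e.extend I x) (R := R)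
    (J := Ioo (-R) R) (inter_subset_left.trans hbt) (by
      ext t
      refine ⟨fun ht => ⟨ht, e.extend_target_subset_range (hbt ?_)⟩, fun ht => ht.1⟩
      rw [Metric.mem_ball, dist_eq_norm, add_sub_cancel_left, norm_smul]
      simpa using abs_lt.2 ht)
  refine ⟨_, _, R, hR, h1, ?_, ?_⟩
  · simp only [zero_smul, add_zero]
    exact e.extend_left_inv hxe
  · rw [h2]
    exact fun y hy => ⟨e, he, hy.1, hball hy.2⟩

theorem exists_isArc_of_notMem_interiorPts
    (hI : range I = univ ∨ range I = {y | 0 ≤ y 0}) {x : M} (hx : x ∉ interiorPts I M) :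
    ∃ (γ : ℝ → M) (u : M → ℝ) (R : ℝ), 0 < R ∧ IsArc γ u (Ico 0 R) ∧ γ 0 = x ∧
      γ '' Ioo 0 R ⊆ interiorPts I M := by
  set e := chartAt H x with he
  have hxe : x ∈ e.source := mem_chart_source H x
  have hxt : e.extend I x ∈ I.symm ⁻¹' e.target := by
    have := (e.extend I).map_source (by rwa [e.extend_source])
    rw [e.extend_target] at this
    exact this.1
  have hA : IsOpen (I.symm ⁻¹' e.target) := e.open_target.preimage I.continuous_symm
  have hint : ∀ y ∈ e.source, e.extend I y ∈ interior (range I) → y ∈ interiorPts I M := by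
    intro y hy hyi
    refine ⟨e, chart_mem_atlas H x, hy, ?_⟩
    have := (e.extend I).map_source (by rwa [e.extend_source])
    rw [e.extend_target] at this ⊢
    rw [interior_inter, hA.interior_eq]
    exact ⟨this.1, hyi⟩
  have hpos : ∀ z : EuclideanSpace ℝ (Fin 1), 0 < z 0 → z ∈ interior (range I) := by
    intro z hz
    rcases hI with h | h
    · rw [h, interior_univ]
      exact mem_univ z
    · have hopen : IsOpen {y : EuclideanSpace ℝ (Fin 1) | 0 < y 0} :=
        isOpen_lt continuous_const (by fun_prop)
      have hsub : {y : EuclideanSpace ℝ (Fin 1) | 0 < y 0} ⊆ {y | 0 ≤ y 0} := by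
        intro y hy
        rw [mem_ofPred_eq] at hy ⊢
        exact hy.le
      rw [h]
      exact interior_maximal hsub hopen hz
  have hrange : range I = {y | 0 ≤ y 0} := by
    refine hI.resolve_left fun h => hx (hint x hxe ?_)
    rw [h, interior_univ]
    exact mem_univ _
  have hc0 : (e.extend I x) 0 = 0 := by
    have h1 : e.extend I x ∈ range I := mem_range_self _
    rw [hrange] at h1
    by_contra hne
    exact hx (hint x hxe (hpos _ (lt_of_le_of_ne h1 (Ne.symm hne))))
  obtain ⟨R, hR, hball⟩ := Metric.isOpen_iff.1 hA _ hxt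
  obtain ⟨h1, h2⟩ := isArc_of_chart (I := I) (e := e) (c := e.extend I x) (R := R)
    (J := Ico 0 R) (by rw [e.extend_target]; exact inter_subset_inter_left _ hball) (by
      ext t
      rw [hrange]
      have h3 : (e.extend I x + t • EuclideanSpace.single (0 : Fin 1) (1 : ℝ)) 0 = t := by
        rw [PiLp.add_apply, hc0]
        simp
      simp only [mem_ofPred_eq, h3, mem_Ico, mem_Ioo]
      constructor
      · exact fun h => ⟨⟨by linarith, h.2⟩, h.1⟩
      · exact fun h => ⟨h.2, h.1.2⟩)
  refine ⟨_, _, R, hR, h1, ?_, ?_⟩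
  · simp only [zero_smul, add_zero]
    exact e.extend_left_inv hxe
  · rintro _ ⟨t, ht, rfl⟩
    have htJ : t ∈ Ico 0 R := ⟨ht.1.le, ht.2⟩
    have h3 : (e.extend I).symm (e.extend I x + t • EuclideanSpace.single (0 : Fin 1) (1 : ℝ)) ∈
        e.source ∩ e.extend I ⁻¹' Metric.ball (e.extend I x) R := h2 ▸ ⟨t, htJ, rfl⟩
    refine hint _ h3.1 (hpos _ ?_)
    have h4 := h1.left_inv t htJ
    simp only [PiLp.sub_apply, hc0, sub_zero] at h4
    rw [h4]
    exact ht.1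

theorem isPreconnected_interiorPts [PreconnectedSpace M]
    (hI : range I = univ ∨ range I = {y | 0 ≤ y 0}) : IsPreconnected (interiorPts I M) := by
  refine isPreconnected_of_locally_nonseparating (isOpen_interiorPts I M) (fun x => ?_)
    fun x => ?_
  · by_cases hx : x ∈ interiorPts I M
    · exact subset_closure hx
    · obtain ⟨γ, u, R, hR, h, h0, hint⟩ := exists_isArc_of_notMem_interiorPts hI hx
      have h1 : ContinuousWithinAt γ (Ioo 0 R) 0 :=
        (h.continuousOn 0 ⟨le_rfl, hR⟩).mono Ioo_subset_Ico_self
      rw [← h0]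
      refine h1.mem_closure ?_ (mapsTo_iff_image_subset.2 hint)
      rw [closure_Ioo hR.ne]
      exact left_mem_Icc.2 hR.le
  · by_cases hx : x ∈ interiorPts I M
    · obtain ⟨γ, u, R, hR, h, h0, hint⟩ := exists_isArc_of_mem_interiorPts hx
      refine ⟨γ '' Ioo (-R) R, h.isOpen_image.mem_nhds ⟨0, ⟨by linarith, hR⟩, h0⟩, ?_⟩
      rw [inter_eq_left.2 hint]
      exact isPreconnected_Ioo.image _ h.continuousOn
    · obtain ⟨γ, u, R, hR, h, h0, hint⟩ := exists_isArc_of_notMem_interiorPts hI hx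
      refine ⟨γ '' Ico 0 R, h.isOpen_image.mem_nhds ⟨0, ⟨le_rfl, hR⟩, h0⟩, ?_⟩
      have : γ '' Ico 0 R ∩ interiorPts I M = γ '' Ioo 0 R := by
        refine Subset.antisymm ?_ (subset_inter (image_mono Ioo_subset_Ico_self) hint)
        rintro _ ⟨⟨t, ht, rfl⟩, hti⟩
        refine ⟨t, ⟨lt_of_le_of_ne ht.1 ?_, ht.2⟩, rfl⟩
        rintro rfl
        exact hx (h0 ▸ hti)
      rw [this]
      exact isPreconnected_Ioo.image _ (h.continuousOn.mono Ioo_subset_Ico_self)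

/-- A chart arc whose inner part is a neighbourhood of a given point `x`, and with end points in the
interior of the manifold, except that the initial point may be `x`. -/
theorem exists_isArc_nhds (hI : range I = univ ∨ range I = {y | 0 ≤ y 0}) (x : M) :
    ∃ (ψ : ℝ → M) (w : M → ℝ) (R A B : ℝ) (J : Set ℝ), IsArc ψ w J ∧ Icc A B ⊆ J ∧
      ψ '' Icc A B ∈ 𝓝 x ∧ ψ B ∈ interiorPts I M ∧
      (ψ A ∈ interiorPts I M ∨
        (x ∉ interiorPts I M ∧ J = Ico 0 R ∧ A = 0 ∧ 0 < B ∧ B < R ∧ ψ 0 = x)) := by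
  by_cases hx : x ∈ interiorPts I M
  · obtain ⟨γ, u, R, hR, h, h0, hint⟩ := exists_isArc_of_mem_interiorPts hx
    have hsub : Icc (-(R / 2)) (R / 2) ⊆ Ioo (-R) R := fun t ht =>
      ⟨by linarith [ht.1], by linarith [ht.2]⟩
    refine ⟨γ, u, R, -(R / 2), R / 2, _, h, hsub, ?_, hint ⟨_, ?_, rfl⟩, Or.inl (hint ⟨_, ?_, rfl⟩)⟩
    · refine Filter.mem_of_superset ((h.isOpen_image_inter
        (isOpen_Ioo (a := -(R / 2)) (b := R / 2))).mem_nhds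
        ⟨0, ⟨⟨by linarith, hR⟩, by linarith, by linarith⟩, h0⟩) (image_mono ?_)
      exact inter_subset_right.trans Ioo_subset_Icc_self
    · exact hsub ⟨by linarith, le_rfl⟩
    · exact hsub ⟨le_rfl, by linarith⟩
  · obtain ⟨γ, u, R, hR, h, h0, hint⟩ := exists_isArc_of_notMem_interiorPts hI hx
    refine ⟨γ, u, R, 0, R / 2, _, h, fun t ht => ⟨ht.1, by linarith [ht.2]⟩, ?_,
      hint ⟨_, ⟨half_pos hR, half_lt_self hR⟩, rfl⟩,
      Or.inr ⟨hx, rfl, rfl, half_pos hR, half_lt_self hR, h0⟩⟩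
    refine Filter.mem_of_superset ((h.isOpen_image_inter
        (isOpen_Iio (a := R / 2))).mem_nhds ⟨0, ⟨⟨le_rfl, hR⟩, half_pos hR⟩, h0⟩) (image_mono ?_)
    exact fun t ht => ⟨ht.1.1, le_of_lt ht.2⟩

theorem isPreconnected_compl_singleton_of_exists [T2Space M] [PreconnectedSpace M]
    (hint : interiorPts I M = univ) {p : M} (hp : IsPreconnected ({p}ᶜ : Set M)) (x : M) :
    IsPreconnected ({x}ᶜ : Set M) := by
  have htr : ∀ x : M, ∃ O : Set M, IsOpen O ∧ x ∈ O ∧ ∀ y ∈ O, ∀ y' ∈ O,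
      IsPreconnected ({y}ᶜ : Set M) → IsPreconnected ({y'}ᶜ : Set M) := by
    intro x
    obtain ⟨O, hO, hxO, h⟩ := locallyTransitiveOn_isotopyGroup (I := I) x (hint ▸ mem_univ x) univ
      Filter.univ_mem
    refine ⟨O, hO, hxO, fun y hy y' hy' hyc => ?_⟩
    obtain ⟨g, -, hg, -⟩ := h y hy y' hy'
    have : ({y'}ᶜ : Set M) = g '' {y}ᶜ := by
      rw [image_compl_eq g.bijective, image_singleton, hg]
    rw [this]
    exact hyc.image _ g.continuous.continuousOn
  have hclopen : IsClopen {x : M | IsPreconnected ({x}ᶜ : Set M)} := by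
    constructor
    · rw [← isOpen_compl_iff, isOpen_iff_mem_nhds]
      intro x hx
      obtain ⟨O, hO, hxO, h⟩ := htr x
      exact Filter.mem_of_superset (hO.mem_nhds hxO) fun y hy hyc => hx (h y hy x hxO hyc)
    · rw [isOpen_iff_mem_nhds]
      intro x hx
      obtain ⟨O, hO, hxO, h⟩ := htr x
      exact Filter.mem_of_superset (hO.mem_nhds hxO) fun y hy => h x hxO y hy hx
  exact eq_univ_iff_forall.1 (hclopen.eq_univ ⟨p, hp⟩) x

theorem exists_interior_nonseparated_dim_one
    (hI : range I = univ ∨ range I = {y | 0 ≤ y 0})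
    [T2Space M] [CompactSpace M] [ConnectedSpace M] (hM : ¬ Nonempty (M ≃ₜ Icc (0 : ℝ) 1)) :
    ∃ V : Set M, V ⊆ interiorPts I M ∧ V.Infinite ∧ ∀ p ∈ V, IsPreconnected (V \ {p}) := by
  choose ψ w R A B J hψ hABJ hnhds hB hA using exists_isArc_nhds (M := M) hI
  obtain ⟨T, -, hT⟩ := isCompact_univ.elim_nhds_subcover
    (fun x => ψ x '' Icc (A x) (B x)) fun x _ => hnhds x
  have hcov : ∀ {O : Set M}, (∀ x ∈ T, MapsTo (ψ x) (Icc (A x) (B x)) O) → IsCompact O := by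
    intro O hO
    have : O = univ := by
      refine univ_subset_iff.1 (hT.trans ?_)
      exact iUnion₂_subset fun x hx => mapsTo_iff_image_subset.1 (hO x hx)
    rw [this]
    exact isCompact_univ
  set F : Set M := ((fun x => ψ x (A x)) '' T ∪ (fun x => ψ x (B x)) '' T) ∩ interiorPts I M with hF
  have hFfin : F.Finite := ((T.finite_toSet.image _).union (T.finite_toSet.image _)).inter_of_left _
  have hFA : ∀ x ∈ T, ψ x (A x) ∈ interiorPts I M → ψ x (A x) ∈ F := fun x hx h =>
    ⟨Or.inl ⟨x, hx, rfl⟩, h⟩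
  have hFB : ∀ x ∈ T, ψ x (B x) ∈ F := fun x hx => ⟨Or.inr ⟨x, hx, rfl⟩, hB x⟩
  have hinj : ∀ x, InjOn (ψ x) (Icc (A x) (B x)) := fun x => (hψ x).injOn.mono (hABJ x)
  have hcont : ∀ x, ContinuousOn (ψ x) (Icc (A x) (B x)) := fun x =>
    (hψ x).continuousOn.mono (hABJ x)
  have hpre := isPreconnected_interiorPts (M := M) hI
  by_cases hint : interiorPts I M = univ
  · obtain ⟨x₀⟩ := (inferInstance : Nonempty M)
    obtain ⟨γ₀, u₀, r, hr, hγ₀, -, hγ₀i⟩ :=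
      exists_isArc_of_mem_interiorPts (I := I) (x := x₀) (hint ▸ mem_univ x₀)
    have h0 : (0 : ℝ) ∈ Ioo (-r) r := ⟨by linarith, hr⟩
    obtain ⟨g, -, hg⟩ := locallyTransitiveOn_isotopyGroup.exists_engulf hpre hγ₀.isOpen_image
      ⟨γ₀ 0, ⟨0, h0, rfl⟩, hγ₀i ⟨0, h0, rfl⟩⟩ hFfin inter_subset_right
    have hγ := hγ₀.comp_homeomorph g.symm
    have hFγ : ∀ y ∈ F, y ∈ (g.symm ∘ γ₀) '' Ioo (-r) r := by
      intro y hy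
      obtain ⟨t, ht, hty⟩ := hg y hy
      exact ⟨t, ht, by simp [hty]⟩
    have hex : ∃ p : M, IsPreconnected ({p}ᶜ : Set M) := by
      by_contra hnone
      refine not_isCompact_of_isArc hγ h0 (fun t ht => ht.2)
        (fun t h1 h2 => ⟨by linarith, h2⟩) (hcov fun x hx => ?_)
      by_contra hne
      exact hnone (hγ.exists_isPreconnected_compl (hψ x) (hABJ x)
        (hFγ _ (hFA x hx (hint ▸ mem_univ _))) (hFγ _ (hFB x hx)) hne)
    obtain ⟨p, hp⟩ := hex
    refine ⟨univ, hint.ge, ?_, fun q _ => ?_⟩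
    · exact ((Ioo_infinite (by linarith : -r < r)).image hγ₀.injOn).mono (subset_univ _)
    · rw [← compl_eq_univ_sdiff]
      exact isPreconnected_compl_singleton_of_exists hint hp q
  · exfalso
    obtain ⟨b, hb⟩ := (ne_univ_iff_exists_notMem _).1 hint
    obtain ⟨γ₀, u₀, r, hr, hγ₀, hγ₀b, hγ₀i⟩ := exists_isArc_of_notMem_interiorPts hI hb
    let Γ : Subgroup (M ≃ₜ M) :=
      { carrier := {g | ∀ x ∉ interiorPts I M, g x = x}
        mul_mem' := fun {f g} hf hg x hx => by
          change f (g x) = x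
          rw [hg x hx, hf x hx]
        one_mem' := fun _ _ => rfl
        inv_mem' := fun {g} hg x hx => by
          change g.symm x = x
          rw [g.symm_apply_eq, hg x hx] }
    have hΓ : LocallyTransitiveOn Γ (interiorPts I M) := by
      intro x hx W hW
      obtain ⟨O, hO, hxO, h⟩ := locallyTransitiveOn_isotopyGroup x hx (W ∩ interiorPts I M)
        (Filter.inter_mem hW ((isOpen_interiorPts I M).mem_nhds hx))
      refine ⟨O, hO, hxO, fun y hy y' hy' => ?_⟩
      obtain ⟨g, -, hgy, hgW⟩ := h y hy y' hy'
      exact ⟨g, fun z hz => hgW z fun h => hz h.2, hgy, fun z hz => hgW z fun h => hz h.1⟩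
    have hhalf : r / 2 ∈ Ioo 0 r := ⟨half_pos hr, half_lt_self hr⟩
    have h0 : (0 : ℝ) ∈ Ico 0 r := ⟨le_rfl, hr⟩
    obtain ⟨g, hgΓ, hg⟩ := hΓ.exists_engulf hpre hγ₀.isOpen_image
      ⟨γ₀ (r / 2), ⟨_, Ioo_subset_Ico_self hhalf, rfl⟩, hγ₀i ⟨_, hhalf, rfl⟩⟩ hFfin
      inter_subset_right
    have hγ := hγ₀.comp_homeomorph g.symm
    have hgs : ∀ x ∉ interiorPts I M, g.symm x = x := fun x hx => by
      rw [g.symm_apply_eq, hgΓ x hx]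
    have hFγ : ∀ y ∈ F, y ∈ (g.symm ∘ γ₀) '' Ico 0 r := by
      intro y hy
      obtain ⟨t, ht, hty⟩ := hg y hy
      exact ⟨t, ht, by simp [hty]⟩
    have hbγ : b ∈ (g.symm ∘ γ₀) '' Ico 0 r := ⟨0, h0, by simp [hγ₀b, hgs b hb]⟩
    have hγb : ∀ x ∉ interiorPts I M, x ∈ (g.symm ∘ γ₀) '' Ico 0 r → x = b := by
      rintro x hx ⟨t, ht, htx⟩
      have h1 : γ₀ t = x := by
        rw [Function.comp_apply, g.symm_apply_eq, hgΓ x hx] at htx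
        exact htx
      rcases ht.1.eq_or_lt with rfl | h2
      · rw [← h1, hγ₀b]
      · exact absurd (h1 ▸ hγ₀i ⟨t, ⟨h2, ht.2⟩, rfl⟩) hx
    refine not_isCompact_of_isArc hγ h0 (fun t ht => ht.2) (fun t h1 h2 => ⟨h1, h2⟩)
      (hcov fun x hx => ?_)
    refine hγ.mapsTo_of_Ico (hcont x) (hinj x) ?_ (hFγ _ (hFB x hx))
    rcases hA x with hAi | ⟨hxi, hJ, hA0, hB0, hBR, hx0⟩
    · exact hFγ _ (hFA x hx hAi)
    · rw [hA0, hx0]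
      by_contra hxγ
      have harc := hψ x
      rw [hJ] at harc
      exact hM (hγ.nonempty_homeomorph_Icc harc hB0 hBR (hx0.symm ▸ hxγ) (hFγ _ (hFB x hx)))

end DimOne

end

noncomputable section

section Main

/-- The action of homeomorphisms by permutations. -/
def homeoToPerm (M : Type*) [TopologicalSpace M] : (M ≃ₜ M) →* Equiv.Perm M where
  toFun f := f.toEquiv
  map_one' := rfl
  map_mul' _ _ := rfl

/-- The action of diffeomorphisms by permutations. -/
def diffeoToPerm {E : Type*} [NormedAddCommGroup E] [NormedSpace ℝ E]
    {H : Type*} [TopologicalSpace H] (I : ModelWithCorners ℝ E H)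
    (M : Type*) [TopologicalSpace M] [ChartedSpace H M] (k : WithTop ℕ∞) :
    (M ≃ₘ^k⟮I, I⟯ M) →* Equiv.Perm M where
  toFun f := f.toEquiv
  map_one' := rfl
  map_mul' _ _ := rfl

theorem isOpen_homeo_mapsTo {M : Type*} [MetricSpace M] [CompactSpace M] {K O : Set M}
    (hK : IsCompact K) (hO : IsOpen O) : IsOpen {g : M ≃ₜ M | MapsTo g K O} := by
  have h1 : Continuous fun f : M ≃ₜ M => (⟨f, f.continuous⟩ : C(M, M)) :=
    continuous_induced_dom
  exact (ContinuousMap.isOpen_setOfPred_mapsTo hK hO).preimage h1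

theorem exists_interior_nonseparated {d : ℕ} [NeZero d] {H : Type*} [TopologicalSpace H]
    (I : ModelWithCorners ℝ (EuclideanSpace ℝ (Fin d)) H)
    (hI : Set.range I = Set.univ ∨ Set.range I = {y | 0 ≤ y 0})
    {M : Type*} [TopologicalSpace M] [T2Space M] [CompactSpace M] [ConnectedSpace M]
    [ChartedSpace H M] (hM : ¬ Nonempty (M ≃ₜ Set.Icc (0 : ℝ) 1)) :
    ∃ V : Set M, V ⊆ interiorPts I M ∧ V.Infinite ∧ ∀ p ∈ V, IsPreconnected (V \ {p}) := by
  rcases (Nat.one_le_iff_ne_zero.2 (NeZero.ne d)).eq_or_lt with h | h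
  · obtain rfl := h
    exact exists_interior_nonseparated_dim_one hI hM
  · refine exists_open_nonseparated ?_
    rw [rank_eq_card_basis (EuclideanSpace.basisFun (Fin d) ℝ).toBasis]
    simpa using h

end Main

end

theorem mainTheorem7 {d : ℕ} [NeZero d] {H : Type*} [TopologicalSpace H]
    (I : ModelWithCorners ℝ (EuclideanSpace ℝ (Fin d)) H)
    (hI : Set.range I = Set.univ ∨ Set.range I = {y | 0 ≤ y 0})
    {M : Type*} [MetricSpace M] [CompactSpace M] [ConnectedSpace M] [ChartedSpace H M]
    (hM : ¬ Nonempty (M ≃ₜ Set.Icc (0 : ℝ) 1))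
    (n : ℕ) (hn : 2 ≤ n) :
    -- the group of homeomorphisms with the `C^0` metric
    (∃ f : Fin n → (M ≃ₜ M), (∀ i, f i ∈ homeoZero M) ∧
      ∃ r : ℝ, 0 < r ∧ ∀ f' : Fin n → (M ≃ₜ M), (∀ i, dist (f' i) (f i) < r) →
        GeneratesDiscreteFree f') ∧
    -- if `M` is smooth: the group of `C^k` diffeomorphisms with the `C^k` topology, and with
    -- any metric that induces this topology
    (IsManifold I ∞ M → ∀ k : ℕ∞, 1 ≤ k →
      ∃ f : Fin n → (M ≃ₘ^∞⟮I, I⟯ M),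
        (∀ i, f i ∈ diffeoZero I M ∞) ∧
        (∀ i, smoothToCk k (f i) ∈ diffeoZero I M k) ∧
        (∃ U : Fin n → Set (M ≃ₘ^(k : WithTop ℕ∞)⟮I, I⟯ M),
          (∀ i, IsOpen (U i) ∧ smoothToCk k (f i) ∈ U i) ∧
          ∀ f' : Fin n → (M ≃ₘ^(k : WithTop ℕ∞)⟮I, I⟯ M), (∀ i, f' i ∈ U i) →
            GeneratesDiscreteFree f') ∧
        ∀ D : MetricSpace (M ≃ₘ^(k : WithTop ℕ∞)⟮I, I⟯ M),
          D.toPseudoMetricSpace.toUniformSpace.toTopologicalSpace = diffeoTopology →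
          ∃ r : ℝ, 0 < r ∧ ∀ f' : Fin n → (M ≃ₘ^(k : WithTop ℕ∞)⟮I, I⟯ M),
            (∀ i, D.dist (f' i) (smoothToCk k (f i)) < r) → GeneratesDiscreteFree f') := by
  obtain ⟨V, hV, hVinf, hVc⟩ := exists_interior_nonseparated I hI hM
  obtain ⟨f, X, q, hf, hX, hq, hq', hpp⟩ := exists_pingPong hV hVinf hVc n
  constructor
  · refine ⟨f, fun i => mem_homeoZero_of_mem_isotopyGroup (hf i), ?_⟩
    have hopen : ∀ i, IsOpen {g : M ≃ₜ M | IsPingPong X i g} := fun i =>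
      isOpen_isPingPong (ρ := fun g : M ≃ₜ M => g) (fun K O => isOpen_homeo_mapsTo) hX i
    choose r hr hrb using fun i => Metric.isOpen_iff.1 (hopen i) (f i) (hpp i)
    obtain ⟨s, hs, hsr⟩ : ∃ s : ℝ, 0 < s ∧ ∀ i, s ≤ r i := by
      have : Nonempty (Fin n) := ⟨⟨0, by omega⟩⟩
      exact ⟨Finset.univ.inf' Finset.univ_nonempty r,
        (Finset.lt_inf'_iff _).2 fun i _ => hr i, fun i => Finset.inf'_le _ (Finset.mem_univ i)⟩
    refine ⟨s, hs, fun f' hf' => ?_⟩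
    exact generatesDiscreteFree_of_isPingPong (homeoToPerm M) (fun g => g.continuous)
      (fun K O => isOpen_homeo_mapsTo) hX hq hq'
      fun i => hrb i (Metric.mem_ball.2 ((hf' i).trans_le (hsr i)))
  · intro hMs k _
    choose F hF hF0 hFk using fun i => exists_diffeo_of_mem_isotopyGroup (hf i)
    have hopen : ∀ i, IsOpen {g : M ≃ₘ^(k : WithTop ℕ∞)⟮I, I⟯ M | IsPingPong X i g} := fun i =>
      isOpen_isPingPong (ρ := fun g : M ≃ₘ^(k : WithTop ℕ∞)⟮I, I⟯ M => g)
        (fun K O => isOpen_diffeo_mapsTo) hX i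
    have hFpp : ∀ i, IsPingPong X i (smoothToCk k (F i)) := by
      intro i
      have : (smoothToCk k (F i) : M → M) = f i := funext (hF i)
      rw [this]
      exact hpp i
    have hgen : ∀ f' : Fin n → (M ≃ₘ^(k : WithTop ℕ∞)⟮I, I⟯ M), (∀ i, IsPingPong X i (f' i)) →
        GeneratesDiscreteFree f' := fun f' hf' =>
      generatesDiscreteFree_of_isPingPong (diffeoToPerm I M k) (fun g => g.continuous)
        (fun K O => isOpen_diffeo_mapsTo) hX hq hq' hf'
    refine ⟨F, hF0, fun i => hFk i k, ⟨fun i => {g | IsPingPong X i g},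
      fun i => ⟨hopen i, hFpp i⟩, hgen⟩, fun D hD => ?_⟩
    have hopen' : ∀ i, IsOpen[D.toPseudoMetricSpace.toUniformSpace.toTopologicalSpace]
        {g : M ≃ₘ^(k : WithTop ℕ∞)⟮I, I⟯ M | IsPingPong X i g} := fun i => hD ▸ hopen i
    choose r hr hrb using fun i =>
      (@Metric.isOpen_iff _ D.toPseudoMetricSpace _).1 (hopen' i) (smoothToCk k (F i)) (hFpp i)
    obtain ⟨s, hs, hsr⟩ : ∃ s : ℝ, 0 < s ∧ ∀ i, s ≤ r i := by
      have : Nonempty (Fin n) := ⟨⟨0, by omega⟩⟩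
      exact ⟨Finset.univ.inf' Finset.univ_nonempty r,
        (Finset.lt_inf'_iff _).2 fun i _ => hr i, fun i => Finset.inf'_le _ (Finset.mem_univ i)⟩
    exact ⟨s, hs, fun f' hf' => hgen f' fun i => hrb i ((hf' i).trans_le (hsr i))⟩
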